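/- Let $N\ge 2$. Let $\rho$ be a state (positive trace class operator of trace $1$) on a Hilbert space tensor product $\mathcal H_1\otimes\cdots\otimes\mathcal H_N$ of complex Hilbert spaces, and let $S_1,\dots,S_N\ge 1$. An $S_1\times\cdots\times S_N$-setting quantum scenario on $\rho$ is given by standard Borel outcome spaces $\Lambda_1,\dots,\Lambda_N$ and normalized positive operator-valued measures $M_n^{(s)}$, $1\le s\le S_n$, on $\Lambda_n$ with values in the bounded operators on $\mathcal H_n$; its joint distributions are the probability measures $P_{(s_1,\dots,s_N)}$ on $\Lambda_1\times\cdots\times\Lambda_N$ with $$P_{(s_1,\dots,s_N)}(F_1\times\cdots\times F_N)=\mathrm{tr}\big[\rho\{M_1^{(s_1)}(F_1)\otimes\cdots\otimes M_N^{(s_N)}(F_N)\}\big].$$ For a family $\Psi=\{\psi_{(s_1,\dots,s_N)}\}$ of bounded measurable real functions on $\Lambda_1\times\cdots\times\Lambda_N$, let $\mathcal B_\Psi=\max\{|\mathcal B_\Psi^{\sup}|,|\mathcal B_\Psi^{\inf}|\}$, where $\mathcal B_\Psi^{\sup}$ and $\mathcal B_\Psi^{\inf}$ are the supremum and the infimum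 of $\sum_{s_1,\dots,s_N}\int\psi_{(s_1,\dots,s_N)}\,dP'_{(s_1,\dots,s_N)}$ over all families $P'$ of joint distributions that admit a local hidden variable model. Let $\Upsilon^{(\rho)}_{S_1\times\cdots\times S_N}$ (the maximal Bell violation) be the supremum, over all $S_1\times\cdots\times S_N$-setting quantum scenarios on $\rho$, of the infimum of the total variation norms of the normalized bounded real-valued measures on $\Lambda_1^{S_1}\times\cdots\times\Lambda_N^{S_N}$ that return all $P_{(s_1,\dots,s_N)}$ as the corresponding marginals. (a) If $S_1=\cdots=S_N=S$, then for every such scenario on $\rho$ and every $\Psi$ $$\Big|\sum_{s_1,\dots,s_N}\int\psi_{(s_1,\dots,s_N)}\,dP_{(s_1,\dots,s_N)}\Big|\le (2S-1)^{N-1}\,\mathcal B_\Psi ,$$ and $\Upsilon^{(\rho)}_{S\times\cdots\times S}\le(2S-1)^{N-1}$; the spaces $\mathcal H_n$ may be infinite-dimensional and the outcome sets infinite. (b) If $\mathcal H_1=\cdots=\mathcal H_N=\mathbb C^d$, then for all $S_1,\dots,S_N\ge1$, every such scenario on $\rho$ and every $\Psi$ $$\Big|\sum_{s_1,\dots,s_N}\int\psi_{(s_1,\dots,s_N)}\,dP_{(s_1,\dots,s_N)}\Big|\le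 \big(2^{N-1}(d^{N-1}-1)+1\big)\,\mathcal B_\Psi ,$$ and $\Upsilon^{(\rho)}_{S_1\times\cdots\times S_N}\le 2^{N-1}(d^{N-1}-1)+1$. -/

import Mathlib

open MeasureTheory ProbabilityTheory
open scoped ENNReal

universe u v

noncomputable section

namespace BellViolation

/-! ### The Hilbert space tensor product of finitely many complex Hilbert spaces

The algebraic tensor product carries the sesquilinear form determined by
`⟪x₁ ⊗ ⋯ ⊗ x_N, y₁ ⊗ ⋯ ⊗ y_N⟫ = ∏ n, ⟪x n, y n⟫`; its Hilbert space completion is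
`H₁ ⊗ ⋯ ⊗ H_N`. -/

section HilbertTensor

variable {N : ℕ} (H : Fin N → Type v)
  [∀ n, NormedAddCommGroup (H n)] [∀ n, InnerProductSpace ℂ (H n)]

/-- The algebraic tensor product, as a type of its own so that it can carry the Hilbert norm
(Mathlib puts the projective seminorm on `PiTensorProduct`). -/
def AlgTensor : Type v := PiTensorProduct ℂ H

instance : AddCommGroup (AlgTensor H) := inferInstanceAs (AddCommGroup (PiTensorProduct ℂ H))
instance : Module ℂ (AlgTensor H) := inferInstanceAs (Module ℂ (PiTensorProduct ℂ H))

variable {H}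

/-- The elementary tensor `x₁ ⊗ ⋯ ⊗ x_N` in the algebraic tensor product. -/
def AlgTensor.tprod (x : ∀ n, H n) : AlgTensor H := PiTensorProduct.tprod ℂ x

/-- `y ↦ ∏ n, ⟪x n, y n⟫` as a multilinear map. -/
def innerRight (x : ∀ n, H n) : MultilinearMap ℂ H ℂ :=
  (MultilinearMap.mkPiAlgebra ℂ (Fin N) ℂ).compLinearMap
    (fun n => (innerSL ℂ (x n)).toLinearMap)

theorem innerRight_apply (x y : ∀ n, H n) : innerRight x y = ∏ n, inner ℂ (x n) (y n) := by
  simp [innerRight]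

/-- The complex conjugate of `t ↦ ⟪x₁ ⊗ ⋯ ⊗ x_N, t⟫`, which is multilinear in `x`. -/
def innerLeft : MultilinearMap ℂ H (AlgTensor H → ℂ) where
  toFun x t := star (PiTensorProduct.lift (innerRight x) t)
  map_update_add' := by
    intro _ m i x y
    funext t
    simp only [Pi.add_apply]
    rw [← star_add]
    congr 1
    induction t using PiTensorProduct.induction_on with
    | smul_tprod r f =>
      simp only [map_smul, PiTensorProduct.lift.tprod, innerRight_apply, smul_eq_mul, ← mul_add]
      congr 1
      classical
      rw [← Finset.mul_prod_erase _ _ (Finset.mem_univ i),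
        ← Finset.mul_prod_erase _ (fun n => inner ℂ (Function.update m i x n) (f n))
          (Finset.mem_univ i),
        ← Finset.mul_prod_erase _ (fun n => inner ℂ (Function.update m i y n) (f n))
          (Finset.mem_univ i)]
      have key : ∀ z : H i, ∏ n ∈ Finset.univ.erase i, inner ℂ (Function.update m i z n) (f n)
          = ∏ n ∈ Finset.univ.erase i, inner ℂ (m n) (f n) := fun z =>
        Finset.prod_congr rfl fun n hn => by
          rw [Function.update_of_ne (Finset.ne_of_mem_erase hn)]
      have e : ‹DecidableEq (Fin N)› = (fun a b => Classical.propDecidable (a = b)) :=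
        Subsingleton.elim _ _
      subst e
      rw [key, key, key]
      simp only [Function.update_self, inner_add_left, add_mul]
    | add a b ha hb => simp only [map_add, ha, hb]; ring
  map_update_smul' := by
    intro _ m i c x
    funext t
    simp only [Pi.smul_apply, smul_eq_mul]
    have : c = star (star c) := (star_star c).symm
    rw [this, ← star_mul', ← this]
    congr 1
    induction t using PiTensorProduct.induction_on with
    | smul_tprod r f =>
      simp only [map_smul, PiTensorProduct.lift.tprod, innerRight_apply, smul_eq_mul]
      rw [mul_left_comm]
      congr 1
      classical
      rw [← Finset.mul_prod_erase _ _ (Finset.mem_univ i),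
        ← Finset.mul_prod_erase _ (fun n => inner ℂ (Function.update m i x n) (f n))
          (Finset.mem_univ i)]
      have key : ∀ z : H i, ∏ n ∈ Finset.univ.erase i, inner ℂ (Function.update m i z n) (f n)
          = ∏ n ∈ Finset.univ.erase i, inner ℂ (m n) (f n) := fun z =>
        Finset.prod_congr rfl fun n hn => by
          rw [Function.update_of_ne (Finset.ne_of_mem_erase hn)]
      have e : ‹DecidableEq (Fin N)› = (fun a b => Classical.propDecidable (a = b)) :=
        Subsingleton.elim _ _
      subst e
      rw [key, key]
      simp only [Function.update_self, inner_smul_left, starRingEnd_apply]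
      ring
    | add a b ha hb => simp only [map_add, ha, hb]; ring

/-- The sesquilinear form on the algebraic tensor product. -/
def algInner (s t : AlgTensor H) : ℂ := star (PiTensorProduct.lift innerLeft s t)

theorem algInner_tprod_left (x : ∀ n, H n) (t : AlgTensor H) :
    algInner (AlgTensor.tprod x) t = PiTensorProduct.lift (innerRight x) t := by
  unfold algInner AlgTensor.tprod
  rw [PiTensorProduct.lift.tprod]
  simp [innerLeft]

theorem algInner_tprod (x y : ∀ n, H n) :
    algInner (AlgTensor.tprod x) (AlgTensor.tprod y) = ∏ n, inner ℂ (x n) (y n) := by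
  rw [algInner_tprod_left, AlgTensor.tprod, PiTensorProduct.lift.tprod, innerRight_apply]

theorem algInner_add_left (s s' t : AlgTensor H) :
    algInner (s + s') t = algInner s t + algInner s' t := by
  unfold algInner
  rw [← star_add]
  congr 1
  exact congrFun (map_add (PiTensorProduct.lift innerLeft) s s') t

theorem algInner_smul_left (c : ℂ) (s t : AlgTensor H) :
    algInner (c • s) t = star c * algInner s t := by
  unfold algInner
  rw [← star_mul']
  congr 1
  exact congrFun (map_smul (PiTensorProduct.lift innerLeft) c s) t

@[elab_as_elim]
theorem AlgTensor.induction {p : AlgTensor H → Prop} (t : AlgTensor H)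
    (h1 : ∀ (c : ℂ) x, p (c • AlgTensor.tprod x)) (h2 : ∀ a b, p a → p b → p (a + b)) : p t :=
  PiTensorProduct.induction_on (motive := p) t h1 h2

theorem algInner_add_right (s t t' : AlgTensor H) :
    algInner s (t + t') = algInner s t + algInner s t' := by
  induction s using AlgTensor.induction with
  | h1 c x =>
    simp only [algInner_smul_left, algInner_tprod_left]
    rw [← mul_add]
    congr 1
    exact map_add (PiTensorProduct.lift (innerRight x)) t t'
  | h2 a b ha hb => simp only [algInner_add_left, ha, hb]; ring

theorem algInner_smul_right (c : ℂ) (s t : AlgTensor H) :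
    algInner s (c • t) = c * algInner s t := by
  induction s using AlgTensor.induction with
  | h1 d x =>
    simp only [algInner_smul_left, algInner_tprod_left]
    rw [mul_left_comm]
    congr 1
    exact map_smul (PiTensorProduct.lift (innerRight x)) c t
  | h2 a b ha hb => simp only [algInner_add_left, ha, hb]; ring

theorem algInner_conj_symm (s t : AlgTensor H) : star (algInner t s) = algInner s t := by
  induction s using AlgTensor.induction with
  | h1 c x =>
    induction t using AlgTensor.induction with
    | h1 d y =>
      simp only [algInner_smul_left, algInner_smul_right, algInner_tprod, star_mul', star_star,
        star_prod]
      have : ∀ n, star (inner ℂ (y n) (x n)) = inner ℂ (x n) (y n) := fun n =>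
        inner_conj_symm _ _
      simp only [this]
      ring
    | h2 a b ha hb => simp only [algInner_add_left, algInner_add_right, star_add, ha, hb]
  | h2 a b ha hb => simp only [algInner_add_left, algInner_add_right, star_add, ha, hb]

theorem AlgTensor.exists_sum (t : AlgTensor H) :
    ∃ (k : ℕ) (c : Fin k → ℂ) (x : Fin k → ∀ n, H n), t = ∑ a, c a • AlgTensor.tprod (x a) := by
  induction t using AlgTensor.induction with
  | h1 c x => exact ⟨1, fun _ => c, fun _ => x, by simp⟩
  | h2 a b ha hb =>
    obtain ⟨k, c, x, rfl⟩ := ha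
    obtain ⟨l, d, y, rfl⟩ := hb
    exact ⟨k + l, Fin.append c d, Fin.append x y, by simp [Fin.sum_univ_add]⟩

theorem algInner_sum {k : ℕ} (c : Fin k → ℂ) (z : Fin k → AlgTensor H) :
    algInner (∑ a, c a • z a) (∑ a, c a • z a)
      = ∑ a, ∑ b, star (c a) * c b * algInner (z a) (z b) := by
  have hl : ∀ t, algInner (∑ a, c a • z a) t = ∑ a, star (c a) * algInner (z a) t := by
    intro t
    let φ : AlgTensor H →+ ℂ := AddMonoidHom.mk' (fun s => algInner s t)
      (fun _ _ => algInner_add_left _ _ _)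
    have := map_sum φ (fun a => c a • z a) Finset.univ
    simp only [φ, AddMonoidHom.mk'_apply] at this
    rw [this]
    simp only [algInner_smul_left]
  have hr : ∀ s, algInner s (∑ a, c a • z a) = ∑ a, c a * algInner s (z a) := by
    intro s
    let φ : AlgTensor H →+ ℂ := AddMonoidHom.mk' (fun t => algInner s t)
      (fun _ _ => algInner_add_right _ _ _)
    have := map_sum φ (fun a => c a • z a) Finset.univ
    simp only [φ, AddMonoidHom.mk'_apply] at this
    rw [this]
    simp only [algInner_smul_right]
  rw [hl]
  refine Finset.sum_congr rfl fun a _ => ?_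
  rw [hr, Finset.mul_sum]
  exact Finset.sum_congr rfl fun b _ => by ring

open Matrix ComplexOrder in
/-- Schur's theorem for several factors: entrywise products preserve `0 ≤ A n ≤ B n`. -/
theorem posSemidef_prod_sub {k : ℕ} {ι : Type*} (A B : ι → Matrix (Fin k) (Fin k) ℂ)
    (hA : ∀ n, (A n).PosSemidef) (hAB : ∀ n, (B n - A n).PosSemidef) (s : Finset ι) :
    (Matrix.of fun a b => ∏ n ∈ s, A n a b).PosSemidef ∧
    (Matrix.of fun a b => ∏ n ∈ s, B n a b - ∏ n ∈ s, A n a b).PosSemidef := by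
  classical
  induction s using Finset.induction_on with
  | empty =>
    constructor
    · have : (Matrix.of fun a b => ∏ n ∈ (∅ : Finset ι), A n a b)
          = Matrix.gram ℂ (fun _ : Fin k => (1 : ℂ)) := by
        ext a b; simp [Matrix.gram]
      rw [this]
      exact Matrix.posSemidef_gram ℂ _
    · have : (Matrix.of fun a b => ∏ n ∈ (∅ : Finset ι), B n a b - ∏ n ∈ (∅ : Finset ι), A n a b)
          = (0 : Matrix (Fin k) (Fin k) ℂ) := by
        ext a b; simp
      rw [this]
      exact Matrix.PosSemidef.zero
  | insert m s hm ih =>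
    obtain ⟨h1, h2⟩ := ih
    constructor
    · have : (Matrix.of fun a b => ∏ n ∈ insert m s, A n a b)
          = A m ⊙ (Matrix.of fun a b => ∏ n ∈ s, A n a b) := by
        ext a b; simp [Finset.prod_insert hm]
      rw [this]
      exact (hA m).hadamard h1
    · have : (Matrix.of fun a b => ∏ n ∈ insert m s, B n a b - ∏ n ∈ insert m s, A n a b)
          = (B m - A m) ⊙ (Matrix.of fun a b => ∏ n ∈ s, A n a b)
            + (B m - A m) ⊙ (Matrix.of fun a b => ∏ n ∈ s, B n a b - ∏ n ∈ s, A n a b)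
            + A m ⊙ (Matrix.of fun a b => ∏ n ∈ s, B n a b - ∏ n ∈ s, A n a b) := by
        ext a b; simp [Finset.prod_insert hm]; ring
      rw [this]
      exact (((hAB m).hadamard h1).add ((hAB m).hadamard h2)).add ((hA m).hadamard h2)

open Matrix ComplexOrder in
theorem re_quadForm_nonneg {k : ℕ} {A : Matrix (Fin k) (Fin k) ℂ} (hA : A.PosSemidef)
    (c : Fin k → ℂ) : 0 ≤ (∑ a, ∑ b, star (c a) * c b * A a b).re := by
  have h := hA.dotProduct_mulVec_nonneg c
  have e : star c ⬝ᵥ A *ᵥ c = ∑ a, ∑ b, star (c a) * c b * A a b := by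
    simp only [dotProduct, mulVec, Finset.mul_sum, Pi.star_apply]
    exact Finset.sum_congr rfl fun a _ => Finset.sum_congr rfl fun b _ => by ring
  rw [e] at h
  exact (Complex.le_def.1 h).1

open ComplexOrder in
theorem algInner_self_nonneg (t : AlgTensor H) : 0 ≤ (algInner t t).re := by
  obtain ⟨k, c, x, rfl⟩ := t.exists_sum
  rw [algInner_sum]
  have h := (posSemidef_prod_sub (fun n => Matrix.gram ℂ fun a => x a n)
    (fun n => Matrix.gram ℂ fun a => x a n) (fun n => Matrix.posSemidef_gram ℂ _)
    (fun n => by rw [sub_self]; exact Matrix.PosSemidef.zero) Finset.univ).1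
  have := re_quadForm_nonneg h c
  simpa [algInner_tprod, Matrix.gram] using this

variable (H) in
/-- The inner product on the algebraic tensor product. -/
@[reducible]
def algCore : PreInnerProductSpace.Core ℂ (AlgTensor H) where
  inner := algInner
  conj_inner_symm s t := algInner_conj_symm s t
  re_inner_nonneg t := algInner_self_nonneg t
  add_left := algInner_add_left
  smul_left s t c := algInner_smul_left c s t

instance : SeminormedAddCommGroup (AlgTensor H) :=
  @InnerProductSpace.Core.toSeminormedAddCommGroup ℂ (AlgTensor H) _ _ _ (algCore H)

instance : InnerProductSpace ℂ (AlgTensor H) := InnerProductSpace.ofCore (algCore H)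

theorem inner_eq_algInner (s t : AlgTensor H) : inner ℂ s t = algInner s t := rfl

variable (H) in
/-- The Hilbert space tensor product `H₁ ⊗ ⋯ ⊗ H_N`. -/
abbrev HilbertTensor : Type v := UniformSpace.Completion (AlgTensor H)

/-- The elementary tensor `x₁ ⊗ ⋯ ⊗ x_N` in `H₁ ⊗ ⋯ ⊗ H_N`. -/
def tprod (x : ∀ n, H n) : HilbertTensor H := (AlgTensor.tprod x : AlgTensor H)

theorem inner_tprod (x y : ∀ n, H n) :
    inner ℂ (tprod x) (tprod y) = ∏ n, inner ℂ (x n) (y n) := by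
  rw [tprod, tprod, UniformSpace.Completion.inner_coe, inner_eq_algInner, algInner_tprod]

/-- `X₁ ⊗ ⋯ ⊗ X_N` on the algebraic tensor product. -/
def algMap (X : ∀ n, H n →L[ℂ] H n) : AlgTensor H →ₗ[ℂ] AlgTensor H :=
  PiTensorProduct.map fun n => (X n).toLinearMap

theorem algMap_tprod (X : ∀ n, H n →L[ℂ] H n) (x : ∀ n, H n) :
    algMap X (AlgTensor.tprod x) = AlgTensor.tprod fun n => X n (x n) :=
  PiTensorProduct.map_tprod _ _

open Matrix ComplexOrder in
theorem posSemidef_gram_sub {E : Type*} [NormedAddCommGroup E] [InnerProductSpace ℂ E]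
    (X : E →L[ℂ] E) {k : ℕ} (x : Fin k → E) :
    (((‖X‖ ^ 2 : ℝ) : ℂ) • Matrix.gram ℂ x - Matrix.gram ℂ fun a => X (x a)).PosSemidef := by
  refine .of_dotProduct_mulVec_nonneg ?_ fun c => ?_
  · refine Matrix.IsHermitian.sub ?_ (Matrix.isHermitian_gram _ _)
    ext a b
    simp [Matrix.gram]
  · rw [sub_mulVec, dotProduct_sub, smul_mulVec, dotProduct_smul, star_dotProduct_gram_mulVec,
      star_dotProduct_gram_mulVec]
    have e : ∑ i, c i • X (x i) = X (∑ i, c i • x i) := by simp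
    rw [e, inner_self_eq_norm_sq_to_K, inner_self_eq_norm_sq_to_K]
    have h := X.le_opNorm (∑ i, c i • x i)
    have h2 : ‖X (∑ i, c i • x i)‖ ^ 2 ≤ ‖X‖ ^ 2 * ‖∑ i, c i • x i‖ ^ 2 := by
      rw [← mul_pow]
      exact pow_le_pow_left₀ (norm_nonneg _) h 2
    rw [sub_nonneg, smul_eq_mul]
    have h3 : ((‖X (∑ i, c i • x i)‖ ^ 2 : ℝ) : ℂ) ≤ ((‖X‖ ^ 2 * ‖∑ i, c i • x i‖ ^ 2 : ℝ) : ℂ) :=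
      Complex.real_le_real.2 h2
    simpa using h3

open ComplexOrder in
theorem norm_algMap_le (X : ∀ n, H n →L[ℂ] H n) (t : AlgTensor H) :
    ‖algMap X t‖ ≤ (∏ n, ‖X n‖) * ‖t‖ := by
  have hP : 0 ≤ ∏ n, ‖X n‖ := Finset.prod_nonneg fun n _ => norm_nonneg _
  refine abs_le_of_sq_le_sq' ?_ (mul_nonneg hP (norm_nonneg _)) |>.2
  rw [mul_pow, @norm_sq_eq_re_inner ℂ, @norm_sq_eq_re_inner ℂ, inner_eq_algInner,
    inner_eq_algInner]
  obtain ⟨k, c, x, rfl⟩ := t.exists_sum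
  have e : algMap X (∑ a, c a • AlgTensor.tprod (x a))
      = ∑ a, c a • AlgTensor.tprod fun n => X n (x a n) := by
    simp [algMap_tprod]
  rw [e, algInner_sum, algInner_sum]
  have h := (posSemidef_prod_sub (fun n => Matrix.gram ℂ fun a => X n (x a n))
    (fun n => ((‖X n‖ ^ 2 : ℝ) : ℂ) • Matrix.gram ℂ fun a => x a n)
    (fun n => Matrix.posSemidef_gram ℂ _)
    (fun n => posSemidef_gram_sub (X n) _) Finset.univ).2
  have h2 := re_quadForm_nonneg h c
  simp only [Matrix.of_apply, Matrix.smul_apply, Matrix.gram_apply, smul_eq_mul,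
    Finset.prod_mul_distrib, mul_sub, Finset.sum_sub_distrib, Complex.sub_re] at h2
  have e2 : (∑ a, ∑ b, star (c a) * c b * ((∏ n, ((‖X n‖ ^ 2 : ℝ) : ℂ))
      * ∏ n, inner ℂ (x a n) (x b n))).re
      = (∏ n, ‖X n‖) ^ 2 * (∑ a, ∑ b, star (c a) * c b * ∏ n, inner ℂ (x a n) (x b n)).re := by
    rw [← Complex.re_ofReal_mul, Finset.mul_sum]
    congr 1
    refine Finset.sum_congr rfl fun a _ => ?_
    rw [Finset.mul_sum]
    refine Finset.sum_congr rfl fun b _ => ?_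
    push_cast
    rw [Finset.prod_pow]
    ring
  rw [e2] at h2
  simp only [algInner_tprod]
  exact sub_nonneg.1 h2

/-- The bounded operator `X₁ ⊗ ⋯ ⊗ X_N` on `H₁ ⊗ ⋯ ⊗ H_N`. -/
def tensorOp (X : ∀ n, H n →L[ℂ] H n) : HilbertTensor H →L[ℂ] HilbertTensor H :=
  ((algMap X).mkContinuous (∏ n, ‖X n‖) (norm_algMap_le X)).completion

theorem tensorOp_tprod (X : ∀ n, H n →L[ℂ] H n) (x : ∀ n, H n) :
    tensorOp X (tprod x) = tprod fun n => X n (x n) := by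
  unfold tensorOp tprod
  simp [algMap_tprod]

end HilbertTensor

/-! ### Trace, states, positive operator-valued measures -/

section Quantum

variable {K : Type v} [NormedAddCommGroup K] [InnerProductSpace ℂ K] [CompleteSpace K]

/-- The diagonal matrix elements of an operator in a fixed orthonormal basis of `K`. -/
def diagElem (T : K →L[ℂ] K) (e : (exists_hilbertBasis ℂ K).choose) : ℂ :=
  inner ℂ (e : K) (T e)

/-- The trace `tr[T] = ∑ₑ ⟪e, T e⟫`, over a fixed orthonormal basis; for a trace class operator
the series converges absolutely and its sum does not depend on the basis. -/
def opTrace (T : K →L[ℂ] K) : ℂ := ∑' e, diagElem T e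

/-- A quantum state (density operator): a positive trace class operator of trace one. -/
structure IsState (ρ : K →L[ℂ] K) : Prop where
  isPositive : ρ.IsPositive
  summable : Summable (diagElem ρ)
  trace_eq_one : opTrace ρ = 1

/-- A normalized positive operator-valued measure on `Λ` with values in the bounded operators on
`K`: positive, normalized, and countably additive in the strong operator topology. Only the values
on measurable sets matter. -/
structure POVM (Λ : Type u) [MeasurableSpace Λ] (K : Type v) [NormedAddCommGroup K]
    [InnerProductSpace ℂ K] [CompleteSpace K] where
  /-- the operator assigned to an event -/
  effect : Set Λ → K →L[ℂ] K
  isPositive : ∀ F, MeasurableSet F → (effect F).IsPositive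
  effect_univ : effect Set.univ = ContinuousLinearMap.id ℂ K
  hasSum_iUnion : ∀ F : ℕ → Set Λ, (∀ i, MeasurableSet (F i)) →
    Pairwise (Function.onFun Disjoint F) →
    ∀ x, HasSum (fun i => effect (F i) x) (effect (⋃ i, F i) x)

end Quantum

/-! ### Correlation scenarios, hidden variable models, Bell-type inequalities -/

section Scenario

variable {N : ℕ}

/-- A joint measurement `(s₁, …, s_N)`: one of the `S n` settings at each site `n`. -/
abbrev Setting (S : Fin N → ℕ) : Type := ∀ n, Fin (S n)

variable {S : Fin N → ℕ} {Λ : Fin N → Type u} [∀ n, MeasurableSpace (Λ n)]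

/-- The scenario with joint distributions `P s` admits a local hidden variable model. -/
def AdmitsLHV (P : Setting S → Measure (∀ n, Λ n)) : Prop :=
  ∃ (Ω : Type u) (_ : MeasurableSpace Ω) (ν : Measure Ω) (_ : IsProbabilityMeasure ν)
    (κ : ∀ n, Fin (S n) → Kernel Ω (Λ n)), (∀ n i, IsMarkovKernel (κ n i)) ∧
    ∀ (s : Setting S) (F : ∀ n, Set (Λ n)), (∀ n, MeasurableSet (F n)) →
      P s (Set.univ.pi F) = ∫⁻ ω, ∏ n, κ n (s n) ω (F n) ∂ν

/-- The linear combination of averages `∑ s, ⟨ψ s⟩` in the scenario `P`. -/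
def bellSum (ψ : Setting S → (∀ n, Λ n) → ℝ) (P : Setting S → Measure (∀ n, Λ n)) : ℝ :=
  ∑ s, ∫ l, ψ s l ∂(P s)

/-- The values of the linear combination over all scenarios admitting an LHV model. -/
def lhvValues (ψ : Setting S → (∀ n, Λ n) → ℝ) : Set ℝ :=
  {x | ∃ P : Setting S → Measure (∀ n, Λ n),
    (∀ s, IsProbabilityMeasure (P s)) ∧ AdmitsLHV P ∧ x = bellSum ψ P}

/-- The LHV constant `max {|B^sup|, |B^inf|}`, where `B^sup` and `B^inf` are the supremum and the
infimum of the linear combination over all scenarios admitting an LHV model. -/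
def lhvConst (ψ : Setting S → (∀ n, Λ n) → ℝ) : ℝ :=
  max |sSup (lhvValues ψ)| |sInf (lhvValues ψ)|

/-- `P` is the family of joint distributions of the quantum scenario given by the state `ρ` and the
POV measures `M n i`: probability measures with
`P s (F₁ × ⋯ × F_N) = tr[ρ (M₁(F₁) ⊗ ⋯ ⊗ M_N(F_N))]`. -/
def IsQuantumScenario {H : Fin N → Type v} [∀ n, NormedAddCommGroup (H n)]
    [∀ n, InnerProductSpace ℂ (H n)] [∀ n, CompleteSpace (H n)]
    (ρ : HilbertTensor H →L[ℂ] HilbertTensor H) (M : ∀ n, Fin (S n) → POVM (Λ n) (H n))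
    (P : Setting S → Measure (∀ n, Λ n)) : Prop :=
  ∀ s, IsProbabilityMeasure (P s) ∧
    ∀ F : ∀ n, Set (Λ n), (∀ n, MeasurableSet (F n)) →
      (((P s).real (Set.univ.pi F) : ℝ) : ℂ)
        = opTrace (ρ ∘L tensorOp fun n => (M n (s n)).effect (F n))

/-- `μ` is a normalized (bounded) real-valued measure on `Λ₁^{S₁} × ⋯ × Λ_N^{S_N}` that returns all
the joint distributions `P s` as its marginals. -/
def IsJointQuasiMeasure (P : Setting S → Measure (∀ n, Λ n))
    (μ : SignedMeasure (∀ n, Fin (S n) → Λ n)) : Prop :=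
  μ Set.univ = 1 ∧ ∀ (s : Setting S) (E : Set (∀ n, Λ n)), MeasurableSet E →
    μ ((fun ω n => ω n (s n)) ⁻¹' E) = (P s).real E

/-- The scenario parameter `γ`: the infimum of the total variation norms of all normalized bounded
real-valued measures returning the joint distributions `P s` as marginals. -/
def scenarioParam (P : Setting S → Measure (∀ n, Λ n)) : ℝ≥0∞ :=
  ⨅ (μ : SignedMeasure (∀ n, Fin (S n) → Λ n)) (_ : IsJointQuasiMeasure P μ),
    μ.totalVariation Set.univ

end Scenario

/-- The maximal `S₁ × ⋯ × S_N`-setting Bell violation `Υ` of a state `ρ`: the supremum of the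
scenario parameter over all outcome spaces (standard measurable spaces) and all collections of POV
measures on them. -/
def maxBellViolation {N : ℕ} {H : Fin N → Type v} [∀ n, NormedAddCommGroup (H n)]
    [∀ n, InnerProductSpace ℂ (H n)] [∀ n, CompleteSpace (H n)]
    (ρ : HilbertTensor H →L[ℂ] HilbertTensor H) (S : Fin N → ℕ) : ℝ≥0∞ :=
  ⨆ (Λ : Fin N → Type u) (_ : ∀ n, MeasurableSpace (Λ n)) (_ : ∀ n, StandardBorelSpace (Λ n))
    (M : ∀ n, Fin (S n) → POVM (Λ n) (H n)) (P : Setting S → Measure (∀ n, Λ n))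
    (_ : IsQuantumScenario ρ M P), scenarioParam P

/-- In every quantum `S₁ × ⋯ × S_N`-setting scenario performed on `ρ`, whatever the outcome spaces,
every Bell-type inequality is violated at most by the factor `c`. -/
def ViolationAtMost {N : ℕ} {H : Fin N → Type v} [∀ n, NormedAddCommGroup (H n)]
    [∀ n, InnerProductSpace ℂ (H n)] [∀ n, CompleteSpace (H n)]
    (ρ : HilbertTensor H →L[ℂ] HilbertTensor H) (S : Fin N → ℕ) (c : ℝ) : Prop :=
  ∀ (Λ : Fin N → Type u) [∀ n, MeasurableSpace (Λ n)] [∀ n, StandardBorelSpace (Λ n)]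
    (M : ∀ n, Fin (S n) → POVM (Λ n) (H n)) (P : Setting S → Measure (∀ n, Λ n)),
    IsQuantumScenario ρ M P →
    ∀ ψ : Setting S → (∀ n, Λ n) → ℝ, (∀ s, Measurable (ψ s)) →
      (∃ C, ∀ s l, |ψ s l| ≤ C) → |bellSum ψ P| ≤ c * lhvConst ψ

end BellViolation

end

/-! Both bounds reduce to one statement, `QuasiModel P c`: the distributions `P s` are the marginals
of a finite real combination `∑ w i • ν i` of probability measures on the predetermined outcomes of
all settings, with `∑ |w i| ≤ c`. Such a combination is a joint real-valued measure of total
variation at most `c`. Integrating `∑ s, ψ s` against each `ν i` is averaging over deterministic LHV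
models, hence gives at most `lhvConst ψ` in absolute value.

For (a) only nonsignaling is used (`NoSignaling.quasiModel`). Fix a site `r`. For each choice of one
setting, or none, at every other site, conditional independence at `r` yields a probability measure
with the correct marginals at the chosen settings and at all settings of `r`, other outcomes being
frozen at a point. Per site, weight `1` on each of the `S` settings and `-(S - 1)` on "none" cancels
every contribution containing a frozen site. The absolute weight is `2 * S - 1` at each of the `N -
1` sites.

For (b) the state is diagonalized, and each eigenvector is written as `∑ κ, x κ ⊗ e κ`, with `κ`
running over the `d ^ (N - 1)` basis vectors of the last `N - 1` sites. Diagonal terms are product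
states. Off-diagonal terms become product states by polarization at every site
(`productDecomp_offDiagonal`). A product state makes all outcomes independent, so it has a joint
probability measure. -/

noncomputable section

namespace BellViolation

/-! ### Signed mixtures of predetermined outcomes and the two bounds they imply -/

section QuasiModel

variable {N : ℕ} {S : Fin N → ℕ} {Λ : Fin N → Type u}

/-- The outcomes that a predetermined assignment `ω` of outcomes to all settings gives to the joint
measurement `s`. -/
def readOut (s : Setting S) (ω : ∀ n, Fin (S n) → Λ n) : ∀ n, Λ n := fun n => ω n (s n)

theorem readOut_apply (s : Setting S) (ω : ∀ n, Fin (S n) → Λ n) (n : Fin N) :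
    readOut s ω n = ω n (s n) := rfl

variable [∀ n, MeasurableSpace (Λ n)]

theorem measurable_readOut (s : Setting S) : Measurable (readOut (Λ := Λ) s) :=
  measurable_pi_lambda _ fun n => (measurable_pi_apply (s n)).comp (measurable_pi_apply n)

/-- The family `P` is returned as the marginals of a finite linear combination, with total weight
at most `c`, of probability measures. -/
def QuasiModel (P : Setting S → Measure (∀ n, Λ n)) (c : ℝ) : Prop :=
  ∃ (ι : Type) (_ : Fintype ι) (w : ι → ℝ) (ν : ι → Measure (∀ n, Fin (S n) → Λ n)),
    (∀ i, IsProbabilityMeasure (ν i)) ∧ ∑ i, |w i| ≤ c ∧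
    ∀ s E, MeasurableSet E → (P s).real E = ∑ i, w i * (ν i).real (readOut s ⁻¹' E)

/-- On a Hahn decomposition `i`, `iᶜ` the total variation is `μ i - μ iᶜ`, and each `ν j`
contributes to this difference a number in `[-1, 1]` times `w j`. -/
theorem totalVariation_univ_le {α ι : Type*} [MeasurableSpace α] [Fintype ι] (w : ι → ℝ)
    (ν : ι → Measure α) [∀ i, IsProbabilityMeasure (ν i)] (μ : SignedMeasure α)
    (hμ : ∀ E, MeasurableSet E → μ E = ∑ i, w i * (ν i).real E) :
    μ.totalVariation Set.univ ≤ ENNReal.ofReal (∑ i, |w i|) := by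
  obtain ⟨i, hi₁, hi₂, hi₃, hp, hn⟩ := μ.toJordanDecomposition_spec
  have h1 : μ.totalVariation Set.univ = ENNReal.ofReal (μ i - μ iᶜ) := by
    rw [← ENNReal.ofReal_toReal (measure_ne_top μ.totalVariation Set.univ)]
    congr 1
    rw [SignedMeasure.totalVariation, ← measureReal_def, measureReal_add_apply, hp, hn,
      SignedMeasure.toMeasureOfZeroLE_real_apply _ _ _ MeasurableSet.univ,
      SignedMeasure.toMeasureOfLEZero_real_apply _ _ _ MeasurableSet.univ]
    simp [sub_eq_add_neg]
  rw [h1, hμ i hi₁, hμ _ hi₁.compl, ← Finset.sum_sub_distrib]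
  refine ENNReal.ofReal_le_ofReal (Finset.sum_le_sum fun j _ => ?_)
  rw [← mul_sub, probReal_compl_eq_one_sub hi₁]
  have h0 : 0 ≤ (ν j).real i := measureReal_nonneg
  have h2 : (ν j).real i ≤ 1 := measureReal_le_one
  calc w j * ((ν j).real i - (1 - (ν j).real i)) ≤ |w j * ((ν j).real i - (1 - (ν j).real i))| :=
        le_abs_self _
    _ = |w j| * |(ν j).real i - (1 - (ν j).real i)| := abs_mul _ _
    _ ≤ |w j| * 1 := by
        refine mul_le_mul_of_nonneg_left ?_ (abs_nonneg _)
        rw [abs_le]; constructor <;> linarith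
    _ = |w j| := mul_one _

theorem QuasiModel.scenarioParam_le {P : Setting S → Measure (∀ n, Λ n)} {c : ℝ}
    (h : QuasiModel P c) [Nonempty (Setting S)] [∀ s, IsProbabilityMeasure (P s)] :
    scenarioParam P ≤ ENNReal.ofReal c := by
  obtain ⟨ι, _, w, ν, hν, hc, hP⟩ := h
  let μ : SignedMeasure (∀ n, Fin (S n) → Λ n) := ∑ i, w i • (ν i).toSignedMeasure
  have hμ : ∀ E, MeasurableSet E → μ E = ∑ i, w i * (ν i).real E := by
    intro E hE
    let φ : SignedMeasure (∀ n, Fin (S n) → Λ n) →+ ℝ :=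
      AddMonoidHom.mk' (fun μ => μ E) fun μ μ' => add_apply μ μ' E
    change φ (∑ i, w i • (ν i).toSignedMeasure) = _
    rw [map_sum]
    refine Finset.sum_congr rfl fun i _ => ?_
    simp [φ, Measure.toSignedMeasure_apply_measurable hE]
  have hmarg : ∀ (s : Setting S) (E : Set (∀ n, Λ n)), MeasurableSet E →
      μ (readOut s ⁻¹' E) = (P s).real E := fun s E hE => by
    rw [hμ _ (measurable_readOut s hE), hP s E hE]
  have hquasi : IsJointQuasiMeasure P μ := by
    refine ⟨?_, hmarg⟩
    -- Normalization is read off from the marginal at any one setting.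
    obtain ⟨s⟩ := ‹Nonempty (Setting S)›
    simpa using hmarg s Set.univ MeasurableSet.univ
  exact (iInf₂_le μ hquasi).trans
    ((totalVariation_univ_le w ν μ hμ).trans (ENNReal.ofReal_le_ofReal hc))

/-- Moving the negative weights to the side of `Q` turns the hypothesis into an equality of positive
measures, against which `f` can be integrated. -/
theorem integral_eq_sum_of_real_eq {α ι : Type*} [MeasurableSpace α] [Fintype ι] (w : ι → ℝ)
    (Q : Measure α) [IsFiniteMeasure Q] (ν : ι → Measure α) [∀ i, IsFiniteMeasure (ν i)]
    (h : ∀ E, MeasurableSet E → Q.real E = ∑ i, w i * (ν i).real E)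
    {f : α → ℝ} (hf : Measurable f) {C : ℝ} (hC : ∀ a, |f a| ≤ C) :
    ∫ a, f a ∂Q = ∑ i, w i * ∫ a, f a ∂(ν i) := by
  have hint : ∀ (m : Measure α) [IsFiniteMeasure m], Integrable f m := fun m _ =>
    Integrable.of_bound hf.aestronglyMeasurable C (Filter.Eventually.of_forall hC)
  let A : ι → Measure α := fun i => (w i).toNNReal • ν i
  let B : ι → Measure α := fun i => (-w i).toNNReal • ν i
  have hw : ∀ i, ((w i).toNNReal : ℝ) - ((-w i).toNNReal : ℝ) = w i := fun i => by
    rw [Real.coe_toNNReal', Real.coe_toNNReal']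
    rcases le_total 0 (w i) with h0 | h0
    · rw [max_eq_left h0, max_eq_right (by linarith)]; ring
    · rw [max_eq_right h0, max_eq_left (by linarith)]; ring
  have key : Q + ∑ i, B i = ∑ i, A i := by
    ext E hE
    rw [← measureReal_eq_measureReal_iff]
    rw [measureReal_add_apply, h E hE]
    simp only [measureReal_def, Measure.finsetSum_apply]
    rw [ENNReal.toReal_sum (fun i _ => measure_ne_top _ _),
      ENNReal.toReal_sum (fun i _ => measure_ne_top _ _), ← Finset.sum_add_distrib]
    refine Finset.sum_congr rfl fun i _ => ?_
    simp only [A, B, Measure.smul_apply, ENNReal.smul_def, smul_eq_mul, ENNReal.toReal_mul,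
      ENNReal.coe_toReal]
    rw [← add_mul]
    congr 1
    linarith [hw i]
  have e := congrArg (fun m => ∫ a, f a ∂m) key
  beta_reduce at e
  rw [integral_add_measure (hint _) (hint _), integral_finsetSum_measure fun i _ => hint _,
    integral_finsetSum_measure fun i _ => hint _, ← eq_sub_iff_add_eq,
    ← Finset.sum_sub_distrib] at e
  rw [e]
  refine Finset.sum_congr rfl fun i _ => ?_
  rw [integral_smul_nnreal_measure, integral_smul_nnreal_measure, NNReal.smul_def, NNReal.smul_def,
    smul_eq_mul, smul_eq_mul, ← sub_mul, hw]

/-- Predetermined outcomes form a local hidden variable model. -/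
theorem admitsLHV_dirac (ω : ∀ n, Fin (S n) → Λ n) :
    AdmitsLHV fun s : Setting S => Measure.dirac (readOut s ω) := by
  refine ⟨PUnit, ⊤, @Measure.dirac _ ⊤ PUnit.unit, inferInstance,
    fun n i => Kernel.const _ (Measure.dirac (ω n i)), fun _ _ => inferInstance, fun s F hF => ?_⟩
  rw [Measure.dirac_apply' _ (MeasurableSet.univ_pi hF)]
  simp only [Kernel.const_apply, lintegral_const, measure_univ, mul_one,
    Measure.dirac_apply' _ (hF _)]
  classical
  rw [Set.indicator_apply, Finset.prod_congr rfl fun n _ => Set.indicator_apply (F n) 1 _]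
  simp only [Pi.one_apply]
  rw [Finset.prod_ite_zero]
  simp [readOut_apply, Set.mem_pi]

theorem abs_bellSum_le_of_bounded {ψ : Setting S → (∀ n, Λ n) → ℝ} {C : ℝ}
    (hC : ∀ s l, |ψ s l| ≤ C) (P : Setting S → Measure (∀ n, Λ n))
    [∀ s, IsProbabilityMeasure (P s)] : |bellSum ψ P| ≤ ∑ _s : Setting S, C := by
  refine (Finset.abs_sum_le_sum_abs _ _).trans (Finset.sum_le_sum fun s _ => ?_)
  have := norm_integral_le_of_norm_le_const (μ := P s) (f := ψ s)
    (Filter.Eventually.of_forall (hC s))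
  simpa using this

/-- A fixed assignment `ω` is itself a deterministic LHV model, so its value lies between the
infimum and the supremum defining `lhvConst`. -/
theorem abs_sum_readOut_le_lhvConst {ψ : Setting S → (∀ n, Λ n) → ℝ} (hm : ∀ s, Measurable (ψ s))
    {C : ℝ} (hC : ∀ s l, |ψ s l| ≤ C) (ω : ∀ n, Fin (S n) → Λ n) :
    |∑ s, ψ s (readOut s ω)| ≤ lhvConst ψ := by
  have hmem : ∑ s, ψ s (readOut s ω) ∈ lhvValues ψ := by
    refine ⟨fun s => Measure.dirac (readOut s ω), fun _ => inferInstance, admitsLHV_dirac ω, ?_⟩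
    refine Finset.sum_congr rfl fun s _ => ?_
    rw [integral_dirac' _ _ (hm s).stronglyMeasurable]
  -- Boundedness is essential: in `ℝ`, `sSup` and `sInf` of a set unbounded in the relevant
  -- direction are `0`.
  have hb : ∀ x ∈ lhvValues ψ, |x| ≤ ∑ _s : Setting S, C := by
    rintro x ⟨P, hP, -, rfl⟩
    exact abs_bellSum_le_of_bounded hC P
  have h1 : ∑ s, ψ s (readOut s ω) ≤ sSup (lhvValues ψ) :=
    le_csSup ⟨_, fun x hx => (abs_le.1 (hb x hx)).2⟩ hmem
  have h2 : sInf (lhvValues ψ) ≤ ∑ s, ψ s (readOut s ω) :=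
    csInf_le ⟨_, fun x hx => (abs_le.1 (hb x hx)).1⟩ hmem
  rw [lhvConst, abs_le]
  constructor
  · have := (neg_abs_le (sInf (lhvValues ψ))).trans h2
    linarith [le_max_right |sSup (lhvValues ψ)| |sInf (lhvValues ψ)|]
  · exact (h1.trans (le_abs_self _)).trans (le_max_left _ _)

theorem QuasiModel.abs_bellSum_le {P : Setting S → Measure (∀ n, Λ n)} {c : ℝ}
    (h : QuasiModel P c) [∀ s, IsProbabilityMeasure (P s)] {ψ : Setting S → (∀ n, Λ n) → ℝ}
    (hm : ∀ s, Measurable (ψ s)) {C : ℝ} (hC : ∀ s l, |ψ s l| ≤ C) :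
    |bellSum ψ P| ≤ c * lhvConst ψ := by
  obtain ⟨ι, _, w, ν, hν, hc, hP⟩ := h
  have hL : 0 ≤ lhvConst ψ := (abs_nonneg _).trans (le_max_left _ _)
  have hint : ∀ (i : ι) (s : Setting S), Integrable (fun ω => ψ s (readOut s ω)) (ν i) :=
    fun i s => Integrable.of_bound ((hm s).comp (measurable_readOut s)).aestronglyMeasurable C
      (Filter.Eventually.of_forall fun ω => hC s _)
  have e : bellSum ψ P = ∑ i, w i * ∫ ω, ∑ s, ψ s (readOut s ω) ∂(ν i) := by
    have : ∀ s, ∫ l, ψ s l ∂(P s) = ∑ i, w i * ∫ ω, ψ s (readOut s ω) ∂(ν i) := fun s => by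
      have : ∀ i, IsFiniteMeasure ((ν i).map (readOut s)) := fun i => inferInstance
      rw [integral_eq_sum_of_real_eq w (P s) (fun i => (ν i).map (readOut s)) (fun E hE => ?_)
        (hm s) (hC s)]
      · refine Finset.sum_congr rfl fun i _ => ?_
        rw [integral_map (measurable_readOut s).aemeasurable (hm s).aestronglyMeasurable]
      · rw [hP s E hE]
        refine Finset.sum_congr rfl fun i _ => ?_
        rw [map_measureReal_apply (measurable_readOut s) hE]
    rw [bellSum, Finset.sum_congr rfl fun s _ => this s, Finset.sum_comm]
    refine Finset.sum_congr rfl fun i _ => ?_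
    rw [integral_finsetSum _ fun s _ => hint i s, Finset.mul_sum]
  rw [e]
  calc |∑ i, w i * ∫ ω, ∑ s, ψ s (readOut s ω) ∂(ν i)|
      ≤ ∑ i, |w i * ∫ ω, ∑ s, ψ s (readOut s ω) ∂(ν i)| := Finset.abs_sum_le_sum_abs _ _
    _ ≤ ∑ i, |w i| * lhvConst ψ := by
        refine Finset.sum_le_sum fun i _ => ?_
        rw [abs_mul]
        refine mul_le_mul_of_nonneg_left ?_ (abs_nonneg _)
        have := norm_integral_le_of_norm_le_const (μ := ν i)
          (f := fun ω => ∑ s, ψ s (readOut s ω))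
          (Filter.Eventually.of_forall fun ω => abs_sum_readOut_le_lhvConst hm hC ω)
        simpa using this
    _ = (∑ i, |w i|) * lhvConst ψ := (Finset.sum_mul _ _ _).symm
    _ ≤ c * lhvConst ψ := mul_le_mul_of_nonneg_right hc hL

theorem violation_bounds_of_quasiModel {H : Fin N → Type v} [∀ n, NormedAddCommGroup (H n)]
    [∀ n, InnerProductSpace ℂ (H n)] [∀ n, CompleteSpace (H n)]
    (ρ : HilbertTensor H →L[ℂ] HilbertTensor H) (hS : ∀ n, 1 ≤ S n) (c : ℝ)
    (h : ∀ (Λ : Fin N → Type u) [∀ n, MeasurableSpace (Λ n)] [∀ n, StandardBorelSpace (Λ n)]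
      (M : ∀ n, Fin (S n) → POVM (Λ n) (H n)) (P : Setting S → Measure (∀ n, Λ n)),
      IsQuantumScenario ρ M P → QuasiModel P c) :
    ViolationAtMost.{u, v} ρ S c ∧ maxBellViolation.{u, v} ρ S ≤ ENNReal.ofReal c := by
  have : Nonempty (Setting S) := ⟨fun n => ⟨0, hS n⟩⟩
  constructor
  · intro Λ _ _ M P hP ψ hm ⟨C, hC⟩
    have := fun s => (hP s).1
    exact (h Λ M P hP).abs_bellSum_le hm hC
  · refine iSup_le fun Λ => iSup_le fun _ => iSup_le fun _ => iSup_le fun M => iSup_le fun P =>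
      iSup_le fun hP => ?_
    have := fun s => (hP s).1
    exact (h Λ M P hP).scenarioParam_le

end QuasiModel

/-! ### Gluing measures along a common marginal -/

section Gluing

variable {X A B : Type*} [Fintype X] [MeasurableSpace A] [MeasurableSpace B]

/-- The product of finitely many Markov kernels with the same source. -/
def kernelPi (κ : X → Kernel B A) [∀ x, IsMarkovKernel (κ x)] : Kernel B (X → A) where
  toFun b := Measure.pi fun x => κ x b
  measurable' := by
    refine Measurable.measure_of_isPiSystem_of_isProbabilityMeasure
      generateFrom_pi.symm isPiSystem_pi ?_
    rintro _ ⟨F, hF, rfl⟩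
    simp only [Measure.pi_pi]
    exact Finset.measurable_prod _ fun x _ => Kernel.measurable_coe _ (hF x (Set.mem_univ x))

instance (κ : X → Kernel B A) [∀ x, IsMarkovKernel (κ x)] : IsMarkovKernel (kernelPi κ) :=
  ⟨fun b => inferInstanceAs (IsProbabilityMeasure (Measure.pi fun x => κ x b))⟩

theorem kernelPi_map_eval (κ : X → Kernel B A) [∀ x, IsMarkovKernel (κ x)] (x : X) :
    (kernelPi κ).map (fun f => f x) = κ x := by
  ext1 b
  rw [Kernel.map_apply _ (measurable_pi_apply x)]
  exact (measurePreserving_eval (fun x => κ x b) x).map_eq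

/-- Finitely many probability measures on `A × B` with the same marginal on `B` are marginals of one
probability measure: make the `A`-components conditionally independent. -/
theorem exists_glue [StandardBorelSpace A] [Nonempty A] (ν : X → Measure (A × B))
    [∀ x, IsProbabilityMeasure (ν x)] (β : Measure B) [IsProbabilityMeasure β]
    (h : ∀ x, (ν x).map Prod.snd = β) :
    ∃ μ : Measure ((X → A) × B), IsProbabilityMeasure μ ∧
      ∀ x, μ.map (fun p => (p.1 x, p.2)) = ν x := by
  have hswap : ∀ x, IsProbabilityMeasure ((ν x).map Prod.swap) := fun x =>
    Measure.isProbabilityMeasure_map measurable_swap.aemeasurable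
  let κ : X → Kernel B A := fun x => ((ν x).map Prod.swap).condKernel
  have hκ : ∀ x, β ⊗ₘ κ x = (ν x).map Prod.swap := fun x => by
    have : ((ν x).map Prod.swap).fst = β := by
      rw [Measure.fst_map_swap, Measure.snd, h]
    rw [← this]
    exact Measure.disintegrate _ _
  refine ⟨(β ⊗ₘ kernelPi κ).map Prod.swap,
    Measure.isProbabilityMeasure_map measurable_swap.aemeasurable, fun x => ?_⟩
  have hev : Measurable fun f : X → A => f x := measurable_pi_apply x
  have h1 : (β ⊗ₘ kernelPi κ).map (Prod.map id fun f : X → A => f x) = (ν x).map Prod.swap := by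
    rw [← hκ x, ← kernelPi_map_eval κ x, Measure.compProd_map hev]
  have h2 := congrArg (Measure.map Prod.swap) h1
  rw [Measure.map_map measurable_swap measurable_swap,
    Measure.map_map measurable_swap (measurable_id.prodMap hev),
    Prod.swap_swap_eq, Measure.map_id] at h2
  rw [← h2, Measure.map_map _ measurable_swap]
  · rfl
  · exact ((measurable_pi_apply x).comp measurable_fst).prodMk measurable_snd

end Gluing

/-! ### Nonsignaling scenarios and the bound by the number of settings -/

section NoSignaling

variable {N : ℕ} {S : Fin N → ℕ} {Λ : Fin N → Type u} [∀ n, MeasurableSpace (Λ n)]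

/-- The joint distribution of the outcomes at the sites in `K` depends only on the settings at the
sites in `K`. -/
def NoSignaling (P : Setting S → Measure (∀ n, Λ n)) : Prop :=
  ∀ (K : Finset (Fin N)) (s s' : Setting S), (∀ n ∈ K, s n = s' n) →
    ∀ F : ∀ n, Set (Λ n), (∀ n, MeasurableSet (F n)) → (∀ n ∉ K, F n = Set.univ) →
      P s (Set.univ.pi F) = P s' (Set.univ.pi F)

theorem measurable_piecewise_const (K : Finset (Fin N)) (pt : ∀ n, Λ n) :
    Measurable fun l : ∀ n, Λ n => K.piecewise l pt := by
  refine measurable_pi_lambda _ fun n => ?_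
  by_cases hn : n ∈ K
  · simpa [hn] using measurable_pi_apply n
  · simp [hn]

/-- Freezing the outcomes off `K` at `pt` is a way to speak of the marginal on `K` without leaving
the space of all outcomes. On rectangles, the frozen coordinates either impose no condition or make
the preimage empty. -/
theorem NoSignaling.map_piecewise_eq {P : Setting S → Measure (∀ n, Λ n)} (h : NoSignaling P)
    [∀ s, IsProbabilityMeasure (P s)] (K : Finset (Fin N)) {s s' : Setting S}
    (hs : ∀ n ∈ K, s n = s' n) (pt : ∀ n, Λ n) :
    (P s).map (fun l => K.piecewise l pt) = (P s').map (fun l => K.piecewise l pt) := by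
  have hm := measurable_piecewise_const K pt
  have hp : ∀ s, IsProbabilityMeasure ((P s).map fun l => K.piecewise l pt) := fun s =>
    Measure.isProbabilityMeasure_map hm.aemeasurable
  refine ext_of_generate_finite _ generateFrom_pi.symm isPiSystem_pi ?_ (by simp)
  rintro _ ⟨F, hF, rfl⟩
  replace hF : ∀ n, MeasurableSet (F n) := fun n => hF n (Set.mem_univ n)
  rw [Measure.map_apply hm (.univ_pi hF), Measure.map_apply hm (.univ_pi hF)]
  by_cases hpt : ∀ n ∉ K, pt n ∈ F n
  · have : (fun l => K.piecewise l pt) ⁻¹' Set.univ.pi F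
        = Set.univ.pi (K.piecewise F fun _ => Set.univ) := by
      ext l
      simp only [Set.mem_preimage, Set.mem_univ_pi]
      refine forall_congr' fun n => ?_
      by_cases hn : n ∈ K <;> simp [hn, hpt]
    rw [this]
    refine h K s s' hs _ (fun n => ?_) fun n hn => by simp [hn]
    by_cases hn : n ∈ K <;> simp [hn, hF]
  · push Not at hpt
    obtain ⟨n, hn, hn'⟩ := hpt
    have : (fun l => K.piecewise l pt) ⁻¹' Set.univ.pi F = ∅ := by
      ext l
      simp only [Set.mem_preimage, Set.mem_univ_pi, Set.mem_empty_iff_false, iff_false, not_forall]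
      exact ⟨n, by simpa [hn] using hn'⟩
    rw [this, measure_empty, measure_empty]

/-- The sites at which the choice `o` of settings is compatible with the setting `s`; the site `r` is
regarded as compatible with everything. -/
def matchingSites (r : Fin N) (o : ∀ n, Option (Fin (S n))) (s : Setting S) : Finset (Fin N) :=
  {n | n = r ∨ o n = some (s n)}

theorem mem_matchingSites {r : Fin N} {o : ∀ n, Option (Fin (S n))} {s : Setting S} {n : Fin N} :
    n ∈ matchingSites r o s ↔ n = r ∨ o n = some (s n) := by
  simp [matchingSites]

/-- In a nonsignaling scenario, one probability measure returns, for one chosen setting at each of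
some sites other than `r` and for all settings at `r`, the joint distributions at these sites. -/
theorem NoSignaling.exists_marginals {P : Setting S → Measure (∀ n, Λ n)} (h : NoSignaling P)
    [∀ s, IsProbabilityMeasure (P s)] (r : Fin N) [StandardBorelSpace (Λ r)] (s₀ : Setting S)
    (pt : ∀ n, Λ n) (o : ∀ n, Option (Fin (S n))) :
    ∃ μ : Measure (∀ n, Fin (S n) → Λ n), IsProbabilityMeasure μ ∧ ∀ s : Setting S,
      μ.map (readOut s) = (P s).map fun l => (matchingSites r o s).piecewise l pt := by
  classical
  have : Nonempty (Λ r) := ⟨pt r⟩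
  -- The chosen settings, completed by `s₀` where none is chosen, with `x` measured at `r`.
  let os : Fin (S r) → Setting S := fun x => Function.update (fun n => (o n).getD (s₀ n)) r x
  let K : Finset (Fin N) := {n | n ≠ r}
  -- Outcomes are recorded only at chosen settings of sites other than `r`; all other slots,
  -- including those of `r`, receive the default `pt`.
  let mg : (∀ n, Λ n) → ∀ n, Fin (S n) → Λ n := fun l n y =>
    if n ≠ r ∧ o n = some y then l n else pt n
  have hmg : Measurable mg := by
    refine measurable_pi_lambda _ fun n => measurable_pi_lambda _ fun y => ?_
    by_cases hn : n ≠ r ∧ o n = some y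
    · simpa only [mg, if_pos hn] using measurable_pi_apply n
    · simp only [mg, if_neg hn, measurable_const]
  have hmgK : ∀ l, mg (K.piecewise l pt) = mg l := fun l => by
    ext n y
    by_cases hn : n = r <;> simp [mg, K, hn]
  have hmr : Measurable fun l : ∀ n, Λ n => (l r, mg l) := (measurable_pi_apply r).prodMk hmg
  let ν : Fin (S r) → Measure (Λ r × ∀ n, Fin (S n) → Λ n) := fun x =>
    (P (os x)).map fun l => (l r, mg l)
  have hν : ∀ x, IsProbabilityMeasure (ν x) := fun x =>
    Measure.isProbabilityMeasure_map hmr.aemeasurable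
  have hβ : IsProbabilityMeasure ((P (os (s₀ r))).map mg) :=
    Measure.isProbabilityMeasure_map hmg.aemeasurable
  -- The settings `os x` differ only at `r`, so by nonsignaling the records `mg` have the same law
  -- for every `x`. This is the common marginal needed for gluing.
  obtain ⟨μ, hμ, hμν⟩ := exists_glue ν ((P (os (s₀ r))).map mg) fun x => by
    have hK := h.map_piecewise_eq K (s := os x) (s' := os (s₀ r)) (fun n hn => by
      have hn : n ≠ r := by simpa [K] using hn
      simp [os, hn]) pt
    have hK' := congrArg (Measure.map mg) hK
    rw [Measure.map_map hmg (measurable_piecewise_const K pt),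
      Measure.map_map hmg (measurable_piecewise_const K pt)] at hK'
    rw [Measure.map_map measurable_snd hmr]
    simpa only [Function.comp_def, hmgK] using hK'
  have hmu : Measurable fun p : (Fin (S r) → Λ r) × (∀ n, Fin (S n) → Λ n) =>
      Function.update p.2 r p.1 := by
    refine measurable_pi_lambda _ fun n => ?_
    by_cases hn : n = r
    · subst hn; simpa using measurable_fst
    · simpa [hn, Function.comp_def] using (measurable_pi_apply n).comp measurable_snd
  refine ⟨μ.map fun p => Function.update p.2 r p.1,
    Measure.isProbabilityMeasure_map hmu.aemeasurable, fun s => ?_⟩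
  have hmu' : Measurable fun p : Λ r × (∀ n, Fin (S n) → Λ n) =>
      Function.update (readOut s p.2) r p.1 := by
    refine measurable_pi_lambda _ fun n => ?_
    by_cases hn : n = r
    · subst hn; simpa using measurable_fst
    · simpa [hn, Function.comp_def] using
        (measurable_pi_apply n).comp ((measurable_readOut s).comp measurable_snd)
  have h1 : readOut s ∘ (fun p : (Fin (S r) → Λ r) × (∀ n, Fin (S n) → Λ n) =>
      Function.update p.2 r p.1) = (fun p : Λ r × (∀ n, Fin (S n) → Λ n) =>
      Function.update (readOut s p.2) r p.1) ∘ fun p => (p.1 (s r), p.2) := by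
    funext p
    ext n
    by_cases hn : n = r
    · subst hn; simp [readOut]
    · simp [readOut, hn]
  have hm3 : Measurable fun p : (Fin (S r) → Λ r) × (∀ n, Fin (S n) → Λ n) => (p.1 (s r), p.2) :=
    ((measurable_pi_apply _).comp measurable_fst).prodMk measurable_snd
  -- Reading out `s` sees only the component `s r` of the glued measure, hence `P (os (s r))`. On
  -- the matching sites `os (s r)` agrees with `s`, so nonsignaling gives `P s` there.
  rw [Measure.map_map (measurable_readOut s) hmu, h1, ← Measure.map_map hmu' hm3, hμν,
    Measure.map_map hmu' hmr, h.map_piecewise_eq (matchingSites r o s) (s := s) (s' := os (s r))]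
  · congr 1
    funext l
    ext n
    by_cases hn : n = r
    · subst hn; simp [Finset.piecewise, mem_matchingSites]
    · simp [mem_matchingSites, hn, readOut, mg, Finset.piecewise]
  · intro n hn
    by_cases hnr : n = r
    · subst hnr; simp [os]
    · have : o n = some (s n) := by simpa [mem_matchingSites, hnr] using hn
      simp [os, hnr, this]

/-- Group the choices `o` by the set `T` of sites where `b` holds. The weight of `T` factors over
the sites, with a factor `0` at each site outside `T`, so only the full set survives. -/
theorem sum_prod_mul_filter {J : Type*} [Fintype J] [DecidableEq J] {α : J → Type*}
    [∀ j, Fintype (α j)] (b : ∀ j, α j → Prop) [∀ j, DecidablePred (b j)] (w : ∀ j, α j → ℝ)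
    (hw₁ : ∀ j, ∑ a, (if b j a then w j a else 0) = 1)
    (hw₀ : ∀ j, ∑ a, (if b j a then 0 else w j a) = 0) (g : Finset J → ℝ) :
    ∑ o : ∀ j, α j, (∏ j, w j (o j)) * g {j | b j (o j)} = g Finset.univ := by
  have h1 : ∀ o : ∀ j, α j, (∏ j, w j (o j)) * g {j | b j (o j)}
      = ∑ T : Finset J, g T * ∏ j, if (b j (o j) ↔ j ∈ T) then w j (o j) else 0 := by
    intro o
    rw [Finset.sum_eq_single (Finset.univ.filter fun j => b j (o j))]
    · simp [mul_comm]
    · intro T _ hT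
      have : ∃ j, ¬ (b j (o j) ↔ j ∈ T) := by
        by_contra! hcon
        exact hT (by ext j; simp [hcon j])
      obtain ⟨j, hj⟩ := this
      rw [Finset.prod_eq_zero (Finset.mem_univ j) (if_neg hj), mul_zero]
    · simp
  simp_rw [h1]
  rw [Finset.sum_comm]
  simp_rw [← Finset.mul_sum]
  have h2 : ∀ T : Finset J, (∑ o : ∀ j, α j, ∏ j, if (b j (o j) ↔ j ∈ T) then w j (o j) else 0)
      = ∏ j, if j ∈ T then 1 else 0 := by
    intro T
    rw [← Fintype.prod_sum fun j a => if (b j a ↔ j ∈ T) then w j a else 0]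
    refine Finset.prod_congr rfl fun j _ => ?_
    by_cases hj : j ∈ T
    · simpa [hj] using hw₁ j
    · simpa [hj, ite_not] using hw₀ j
  simp_rw [h2]
  rw [Finset.sum_eq_single Finset.univ]
  · simp
  · intro T _ hT
    obtain ⟨j, hj⟩ : ∃ j, j ∉ T := by
      by_contra! hcon
      exact hT (Finset.eq_univ_iff_forall.2 hcon)
    rw [Finset.prod_eq_zero (Finset.mem_univ j) (if_neg hj), mul_zero]
  · simp

theorem NoSignaling.quasiModel {P : Setting S → Measure (∀ n, Λ n)} (h : NoSignaling P)
    [∀ s, IsProbabilityMeasure (P s)] (r : Fin N) [StandardBorelSpace (Λ r)]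
    (hS : ∀ n, 1 ≤ S n) :
    QuasiModel P (∏ n ∈ Finset.univ.erase r, (2 * (S n : ℝ) - 1)) := by
  classical
  let s₀ : Setting S := fun n => ⟨0, hS n⟩
  obtain ⟨pt⟩ : Nonempty (∀ n, Λ n) := nonempty_of_isProbabilityMeasure (P s₀)
  choose μ hμ hμP using h.exists_marginals r s₀ pt
  -- At a site `n ≠ r`, the compatible choice `some (s n)` has weight `1`, and the other `S n - 1`
  -- settings cancel against `none`. At `r` nothing has to be chosen, so all weight sits on `none`.
  let w : ∀ n, Option (Fin (S n)) → ℝ := fun n a =>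
    if n = r then (if a = none then 1 else 0) else (if a = none then -((S n : ℝ) - 1) else 1)
  refine ⟨∀ n, Option (Fin (S n)), inferInstance, fun o => ∏ n, w n (o n), μ, hμ, ?_, ?_⟩
  · simp_rw [Finset.abs_prod]
    rw [← Fintype.prod_sum fun n a => |w n a|, ← Finset.mul_prod_erase _ _ (Finset.mem_univ r)]
    have h1 : ∑ a, |w r a| = 1 := by simp [w, Fintype.sum_option]
    rw [h1, one_mul]
    refine (Finset.prod_congr rfl fun n hn => ?_).le
    have hn : n ≠ r := Finset.ne_of_mem_erase hn
    have hn1 : (0 : ℝ) ≤ (S n : ℝ) - 1 := by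
      have : (1 : ℝ) ≤ S n := by exact_mod_cast hS n
      linarith
    rw [Fintype.sum_option]
    simp only [w, hn, if_false, if_true, reduceCtorEq, abs_neg, abs_of_nonneg hn1, abs_one,
      Finset.sum_const, Finset.card_univ, Fintype.card_fin, nsmul_eq_mul]
    ring
  · intro s E hE
    have h1 : ∀ o, (μ o).real (readOut s ⁻¹' E)
        = ((P s).map fun l => (matchingSites r o s).piecewise l pt).real E := fun o => by
      rw [← hμP o s, map_measureReal_apply (measurable_readOut s) hE]
    simp_rw [h1]
    refine Eq.trans (by simp) (sum_prod_mul_filter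
      (fun n (a : Option (Fin (S n))) => n = r ∨ a = some (s n)) w (fun n => ?_) (fun n => ?_)
      fun T => ((P s).map fun l => T.piecewise l pt).real E).symm
    · by_cases hn : n = r <;> simp [w, hn]
    · by_cases hn : n = r
      · simp [w, hn]
      · have : ∑ y : Fin (S n), (if y = s n then (0 : ℝ) else 1) = (S n : ℝ) - 1 := by
          have h3 : ∀ y : Fin (S n), (if y = s n then (0 : ℝ) else 1)
              = 1 - if y = s n then 1 else 0 := fun y => by split_ifs <;> simp
          simp [h3]
        simp [w, hn, Fintype.sum_option, this]

/-- Quantum scenarios are nonsignaling. -/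
theorem IsQuantumScenario.noSignaling {H : Fin N → Type v} [∀ n, NormedAddCommGroup (H n)]
    [∀ n, InnerProductSpace ℂ (H n)] [∀ n, CompleteSpace (H n)]
    {ρ : HilbertTensor H →L[ℂ] HilbertTensor H} {M : ∀ n, Fin (S n) → POVM (Λ n) (H n)}
    {P : Setting S → Measure (∀ n, Λ n)} (h : IsQuantumScenario ρ M P) : NoSignaling P := by
  intro K s s' hs F hF hK
  have := fun s => (h s).1
  rw [← measureReal_eq_measureReal_iff, ← Complex.ofReal_inj, (h s).2 F hF, (h s').2 F hF]
  congr 3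
  funext n
  -- Off `K` the event is trivial and its effect is the identity, whatever the setting.
  by_cases hn : n ∈ K
  · rw [hs n hn]
  · rw [hK n hn, POVM.effect_univ, POVM.effect_univ]

end NoSignaling

/-! ### Signed combinations of pure product states and polarization -/

section ProductDecomp

variable {N : ℕ} {H : Fin N → Type v} [∀ n, NormedAddCommGroup (H n)]
  [∀ n, InnerProductSpace ℂ (H n)]

/-- The functional `R` of positive operators is a real linear combination, with total weight at most
`c`, of expectations in pure product states. -/
def ProductDecomp (R : (∀ n, H n →L[ℂ] H n) → ℝ) (c : ℝ) : Prop :=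
  ∃ (ι : Type) (_ : Fintype ι) (w : ι → ℝ) (x : ι → ∀ n, H n),
    (∀ i n, ‖x i n‖ = 1) ∧ ∑ i, |w i| ≤ c ∧
    ∀ X : ∀ n, H n →L[ℂ] H n, (∀ n, (X n).IsPositive) →
      R X = ∑ i, w i * ∏ n, (inner ℂ (x i n) (X n (x i n))).re

theorem ProductDecomp.sum {κ : Type} [Fintype κ] {a : κ → ℝ} (ha : ∀ k, 0 ≤ a k)
    {R : κ → (∀ n, H n →L[ℂ] H n) → ℝ} {c : κ → ℝ} (h : ∀ k, ProductDecomp (R k) (c k)) :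
    ProductDecomp (fun X => ∑ k, a k * R k X) (∑ k, a k * c k) := by
  choose ι hι w x hx hw hR using h
  refine ⟨Σ k, ι k, inferInstance, fun i => a i.1 * w i.1 i.2, fun i => x i.1 i.2,
    fun i => hx i.1 i.2, ?_, fun X hX => ?_⟩
  · rw [Fintype.sum_sigma]
    refine Finset.sum_le_sum fun k _ => ?_
    simp only [abs_mul, abs_of_nonneg (ha k), ← Finset.mul_sum]
    exact mul_le_mul_of_nonneg_left (hw k) (ha k)
  · rw [Fintype.sum_sigma]
    refine Finset.sum_congr rfl fun k _ => ?_
    rw [hR k X hX, Finset.mul_sum]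
    exact Finset.sum_congr rfl fun i _ => (mul_assoc _ _ _).symm

theorem ProductDecomp.mono {R : (∀ n, H n →L[ℂ] H n) → ℝ} {c c' : ℝ} (h : ProductDecomp R c)
    (hc : c ≤ c') : ProductDecomp R c' := by
  obtain ⟨ι, hι, w, x, hx, hw, hR⟩ := h
  exact ⟨ι, hι, w, x, hx, hw.trans hc, hR⟩

theorem ProductDecomp.congr {R R' : (∀ n, H n →L[ℂ] H n) → ℝ} {c : ℝ} (h : ProductDecomp R c)
    (hR' : ∀ X, (∀ n, (X n).IsPositive) → R' X = R X) : ProductDecomp R' c := by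
  obtain ⟨ι, hι, w, x, hx, hw, hR⟩ := h
  exact ⟨ι, hι, w, x, hx, hw, fun X hX => (hR' X hX).trans (hR X hX)⟩

/-- Each vector is normalized and its squared norm absorbed into the weight; a zero vector is
replaced by an arbitrary unit vector carrying weight `0`. -/
theorem productDecomp_of_vectors [∀ n, Nontrivial (H n)] {ι : Type} [Fintype ι] (w : ι → ℝ)
    (y : ι → ∀ n, H n) :
    ProductDecomp (fun X => ∑ i, w i * ∏ n, (inner ℂ (y i n) (X n (y i n))).re)
      (∑ i, |w i| * ∏ n, ‖y i n‖ ^ 2) := by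
  have hu : ∀ i n, ∃ x : H n, ‖x‖ = 1 ∧ y i n = (‖y i n‖ : ℂ) • x := fun i n => by
    by_cases h0 : y i n = 0
    · obtain ⟨x, hx⟩ := exists_norm_eq (H n) (zero_le_one (α := ℝ))
      exact ⟨x, hx, by simp [h0]⟩
    · have h1 : (‖y i n‖ : ℂ) ≠ 0 := by simpa using h0
      refine ⟨(‖y i n‖ : ℂ)⁻¹ • y i n, ?_, ?_⟩
      · rw [norm_smul, norm_inv, Complex.norm_real, norm_norm, inv_mul_cancel₀ (by simpa using h0)]
      · rw [smul_smul, mul_inv_cancel₀ h1, one_smul]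
  choose x hx hy using hu
  refine ⟨ι, inferInstance, fun i => w i * ∏ n, ‖y i n‖ ^ 2, x, hx, ?_, fun X _ => ?_⟩
  · refine (Finset.sum_congr rfl fun i _ => ?_).le
    have h0 : 0 ≤ ∏ n, ‖y i n‖ ^ 2 := Finset.prod_nonneg fun n _ => sq_nonneg _
    rw [abs_mul, abs_of_nonneg h0]
  · refine Finset.sum_congr rfl fun i _ => ?_
    rw [mul_assoc, ← Finset.prod_mul_distrib]
    congr 1
    refine Finset.prod_congr rfl fun n _ => ?_
    conv_lhs => rw [hy i n]
    rw [map_smul, inner_smul_left, inner_smul_right, ← mul_assoc, Complex.conj_ofReal,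
      ← Complex.ofReal_mul, Complex.re_ofReal_mul, pow_two]

theorem productDecomp_pure [∀ n, Nontrivial (H n)] (x : ∀ n, H n) :
    ProductDecomp (fun X => (∏ n, inner ℂ (x n) (X n (x n))).re) (∏ n, ‖x n‖ ^ 2) := by
  have h := productDecomp_of_vectors (fun _ : Unit => (1 : ℝ)) fun _ => x
  simp only [Finset.univ_unique, Finset.sum_singleton, abs_one, one_mul] at h
  refine h.congr fun X hX => ?_
  -- Diagonal elements of positive operators are real, so the real part passes through the product.
  have : ∀ n, inner ℂ (x n) (X n (x n)) = ((inner ℂ (x n) (X n (x n))).re : ℂ) := fun n =>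
    (Complex.ext rfl (by simpa using ((Complex.le_def.1 ((hX n).inner_nonneg_right (x n))).2).symm))
  rw [Finset.prod_congr rfl fun n _ => this n, ← Complex.ofReal_prod, Complex.ofReal_re]

theorem inner_eq_polarization {E : Type*} [NormedAddCommGroup E] [InnerProductSpace ℂ E]
    (T : E →L[ℂ] E) (x y : E) :
    inner ℂ x (T y) = ∑ t : Fin 4, 4⁻¹ * (-Complex.I) ^ (t : ℕ) *
      inner ℂ (x + Complex.I ^ (t : ℕ) • y) (T (x + Complex.I ^ (t : ℕ) • y)) := by
  have e3 : Complex.I ^ 3 = -Complex.I := by rw [pow_succ, Complex.I_sq]; ring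
  have e3' : (-Complex.I) ^ 3 = Complex.I := by rw [neg_pow, e3]; ring
  have e2' : (-Complex.I) ^ 2 = -1 := by rw [neg_sq, Complex.I_sq]
  have hI := Complex.I_sq
  simp only [Fin.sum_univ_four, Fin.val_zero, Fin.val_one, Fin.val_two, pow_zero, pow_one, e3, e3',
    Complex.I_sq, e2', show ((3 : Fin 4) : ℕ) = 3 from rfl, map_add, map_smul, inner_add_left,
    inner_add_right, inner_smul_left, inner_smul_right, map_neg, map_one, Complex.conj_I]
  ring_nf
  simp only [hI]
  ring

/-- By the parallelogram law for `y` and for `Complex.I • y`, the even and the odd `t` contribute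
equally: this gives the total weight and makes the alternating sum vanish. -/
theorem sum_norm_sq_polarization {E : Type*} [NormedAddCommGroup E] [InnerProductSpace ℂ E]
    (x y : E) :
    ∑ t : Fin 4, 4⁻¹ * ‖x + Complex.I ^ (t : ℕ) • y‖ ^ 2 = ‖x‖ ^ 2 + ‖y‖ ^ 2 ∧
    ∑ t : Fin 4, (-1) ^ (t : ℕ) * (4⁻¹ * ‖x + Complex.I ^ (t : ℕ) • y‖ ^ 2) = 0 := by
  have e3 : Complex.I ^ 3 = -Complex.I := by rw [pow_succ, Complex.I_sq]; ring
  have h1 := parallelogram_law_with_norm ℂ x y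
  have h2 := parallelogram_law_with_norm ℂ x (Complex.I • y)
  rw [norm_smul, Complex.norm_I, one_mul] at h2
  simp only [Fin.sum_univ_four, Fin.val_zero, Fin.val_one, Fin.val_two, pow_zero, pow_one, e3,
    Complex.I_sq, show ((3 : Fin 4) : ℕ) = 3 from rfl, neg_smul, one_smul, ← sub_eq_add_neg]
  constructor <;> nlinarith

/-- Odd powers are purely imaginary and drop out under the real part. Writing this parity condition
as a sum of two characters lets the weights factor over the sites; it is the source of the `1 / 2`
in `productDecomp_offDiagonal`. -/
theorem abs_re_neg_I_pow (k : ℕ) : |((-Complex.I) ^ k).re| = (1 + (-1) ^ k) / 2 := by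
  have h4 : (-Complex.I) ^ 4 = 1 := by rw [neg_pow, Complex.I_pow_four]; norm_num
  have h4' : (-1 : ℝ) ^ 4 = 1 := by norm_num
  rw [← Nat.div_add_mod k 4, pow_add, pow_add, pow_mul, pow_mul, h4, h4', one_pow, one_pow, one_mul,
    one_mul]
  have : k % 4 < 4 := Nat.mod_lt _ (by norm_num)
  interval_cases k % 4 <;> simp [pow_succ]

/-- Polarization at every site. -/
theorem productDecomp_offDiagonal [∀ n, Nontrivial (H n)] [Nonempty (Fin N)] (x y : ∀ n, H n) :
    ProductDecomp (fun X => (∏ n, inner ℂ (x n) (X n (y n))).re)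
      ((∏ n, (‖x n‖ ^ 2 + ‖y n‖ ^ 2)) / 2) := by
  let f : (Fin N → Fin 4) → ∀ n, H n := fun t n => x n + Complex.I ^ (t n : ℕ) • y n
  let w : (Fin N → Fin 4) → ℝ := fun t => (∏ n, 4⁻¹ * (-Complex.I) ^ (t n : ℕ)).re
  have hw : ∀ t, w t = (∏ _n : Fin N, 4⁻¹) * ((-Complex.I) ^ (∑ n, (t n : ℕ))).re := fun t => by
    simp only [w]
    rw [Finset.prod_mul_distrib, Finset.prod_pow_eq_pow_sum, ← Complex.re_ofReal_mul]
    norm_num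
  refine ((productDecomp_of_vectors w f).mono ?_).congr fun X hX => ?_
  · have h1 : ∀ t, |w t| * ∏ n, ‖f t n‖ ^ 2
        = ((∏ n, 4⁻¹ * ‖f t n‖ ^ 2) + ∏ n, (-1) ^ (t n : ℕ) * (4⁻¹ * ‖f t n‖ ^ 2)) / 2 := by
      intro t
      rw [hw, abs_mul, abs_re_neg_I_pow, abs_of_nonneg (Finset.prod_nonneg fun _ _ => by norm_num),
        Finset.prod_mul_distrib, Finset.prod_mul_distrib, Finset.prod_mul_distrib,
        Finset.prod_pow_eq_pow_sum]
      ring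
    simp_rw [h1]
    rw [← Finset.sum_div, Finset.sum_add_distrib,
      ← Fintype.prod_sum fun n (a : Fin 4) => 4⁻¹ * ‖x n + Complex.I ^ (a : ℕ) • y n‖ ^ 2,
      ← Fintype.prod_sum fun n (a : Fin 4) =>
        (-1) ^ (a : ℕ) * (4⁻¹ * ‖x n + Complex.I ^ (a : ℕ) • y n‖ ^ 2)]
    simp only [(sum_norm_sq_polarization _ _).1, (sum_norm_sq_polarization _ _).2]
    -- The alternating sum is `0` at every site; its product vanishes because there is at least one
    -- site.
    have h0 : ∏ _n : Fin N, (0 : ℝ) = 0 :=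
      Finset.prod_eq_zero (Finset.mem_univ (Classical.arbitrary (Fin N))) rfl
    rw [h0, add_zero]
  · have hre : ∀ (t : Fin N → Fin 4) n,
        inner ℂ (f t n) (X n (f t n)) = ((inner ℂ (f t n) (X n (f t n))).re : ℂ) := fun t n =>
      Complex.ext rfl
        (by simpa using ((Complex.le_def.1 ((hX n).inner_nonneg_right (f t n))).2).symm)
    rw [Finset.prod_congr rfl fun n _ => inner_eq_polarization (X n) (x n) (y n), Fintype.prod_sum,
      Complex.re_sum]
    refine Finset.sum_congr rfl fun t _ => ?_
    rw [Finset.prod_mul_distrib, Finset.prod_congr rfl fun n _ => hre t n, ← Complex.ofReal_prod,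
      Complex.re_mul_ofReal]

end ProductDecomp

/-! ### From product states to joint probability measures -/

section ProductMeasures

theorem POVM.effect_empty {Λ : Type u} [MeasurableSpace Λ] {K : Type v} [NormedAddCommGroup K]
    [InnerProductSpace ℂ K] [CompleteSpace K] (M : POVM Λ K) : M.effect ∅ = 0 := by
  ext x
  have h := M.hasSum_iUnion (fun _ => ∅) (fun _ => MeasurableSet.empty)
    (fun _ _ _ => disjoint_bot_left) x
  simpa using (summable_const_iff _).1 h.summable

/-- The outcome distribution of a POV measure in a pure state. -/
theorem POVM.exists_measure {Λ : Type u} [MeasurableSpace Λ] {K : Type v} [NormedAddCommGroup K]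
    [InnerProductSpace ℂ K] [CompleteSpace K] (M : POVM Λ K) {x : K} (hx : ‖x‖ = 1) :
    ∃ μ : Measure Λ, IsProbabilityMeasure μ ∧
      ∀ F, MeasurableSet F → μ.real F = (inner ℂ x (M.effect F x)).re := by
  have hpos : ∀ F, MeasurableSet F → 0 ≤ (inner ℂ x (M.effect F x)).re := fun F hF =>
    (M.isPositive F hF).re_inner_nonneg_right x
  let μ : Measure Λ := Measure.ofMeasurable
    (fun F _ => ENNReal.ofReal (inner ℂ x (M.effect F x)).re) (by simp [M.effect_empty])
    (fun F hF hd => by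
      have h := (Complex.hasSum_iff _ _).1 ((M.hasSum_iUnion F hF hd x).mapL (innerSL ℂ x)) |>.1
      simp only [innerSL_apply_apply] at h
      rw [← h.tsum_eq, ENNReal.ofReal_tsum_of_nonneg (fun i => hpos _ (hF i)) h.summable])
  have hμ : ∀ F, MeasurableSet F → μ F = ENNReal.ofReal (inner ℂ x (M.effect F x)).re :=
    fun F hF => Measure.ofMeasurable_apply F hF
  refine ⟨μ, ⟨?_⟩, fun F hF => ?_⟩
  · rw [hμ _ MeasurableSet.univ, M.effect_univ]
    simp [hx]
  · rw [measureReal_def, hμ F hF, ENNReal.toReal_ofReal (hpos F hF)]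

variable {N : ℕ} {S : Fin N → ℕ} {Λ : Fin N → Type u} [∀ n, MeasurableSpace (Λ n)]

/-- A π-λ argument. The full rectangle gives `∑ i, w i = 1`, which is what closes the class under
complements. -/
theorem real_eq_sum_of_rectangles {ι : Type*} [Fintype ι] (w : ι → ℝ)
    (Q : Measure (∀ n, Λ n)) [IsProbabilityMeasure Q] (ν : ι → Measure (∀ n, Λ n))
    [∀ i, IsProbabilityMeasure (ν i)]
    (h : ∀ F : ∀ n, Set (Λ n), (∀ n, MeasurableSet (F n)) →
      Q.real (Set.univ.pi F) = ∑ i, w i * (ν i).real (Set.univ.pi F))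
    (E : Set (∀ n, Λ n)) (hE : MeasurableSet E) : Q.real E = ∑ i, w i * (ν i).real E := by
  have hw : 1 = ∑ i, w i := by simpa using h (fun _ => Set.univ) fun _ => MeasurableSet.univ
  have hgen : (MeasurableSpace.pi : MeasurableSpace (∀ n, Λ n)) = _ := generateFrom_pi.symm
  induction E, hE using MeasurableSpace.induction_on_inter hgen isPiSystem_pi with
  | empty => simp
  | basic E hE =>
    obtain ⟨F, hF, rfl⟩ := hE
    exact h F fun n => hF n (Set.mem_univ n)
  | compl E hE ih =>
    simp only [probReal_compl_eq_one_sub hE, ih, mul_sub, mul_one, Finset.sum_sub_distrib, ← hw]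
  | iUnion F hd hF ih =>
    have hs : ∀ (m : Measure (∀ n, Λ n)) [IsProbabilityMeasure m],
        HasSum (fun i => m.real (F i)) (m.real (⋃ i, F i)) := fun m _ => by
      have hne : ∑' i, m (F i) ≠ ∞ := by
        rw [← measure_iUnion hd hF]
        exact measure_ne_top _ _
      rw [measureReal_def, measure_iUnion hd hF,
        ENNReal.tsum_toReal_eq fun i => measure_ne_top _ _]
      exact ENNReal.hasSum_toReal hne
    refine (hs Q).unique ?_
    simp only [ih]
    exact hasSum_sum fun i _ => (hs (ν i)).mul_left (w i)

/-- In a product state the sites are independent, so the product measure over all sites and all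
settings has the right marginals on rectangles, and these determine the rest. -/
theorem ProductDecomp.quasiModel {H : Fin N → Type v} [∀ n, NormedAddCommGroup (H n)]
    [∀ n, InnerProductSpace ℂ (H n)] [∀ n, CompleteSpace (H n)]
    {ρ : HilbertTensor H →L[ℂ] HilbertTensor H} {M : ∀ n, Fin (S n) → POVM (Λ n) (H n)}
    {P : Setting S → Measure (∀ n, Λ n)} (hP : IsQuantumScenario ρ M P) {c : ℝ}
    (h : ProductDecomp (fun X : ∀ n, H n →L[ℂ] H n => (opTrace (ρ ∘L tensorOp X)).re) c) :
    QuasiModel P c := by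
  obtain ⟨ι, hι, w, x, hx, hw, hR⟩ := h
  have : ∀ (i : ι) (n : Fin N) (y : Fin (S n)), ∃ μ : Measure (Λ n), IsProbabilityMeasure μ ∧
      ∀ F, MeasurableSet F → μ.real F = (inner ℂ (x i n) ((M n y).effect F (x i n))).re :=
    fun i n y => (M n y).exists_measure (hx i n)
  choose μ hμ hμF using this
  let ν : ι → Measure (∀ n, Fin (S n) → Λ n) := fun i => Measure.pi fun n => Measure.pi (μ i n)
  have hν : ∀ i, IsProbabilityMeasure (ν i) := fun i =>
    inferInstanceAs (IsProbabilityMeasure (Measure.pi fun n => Measure.pi (μ i n)))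
  refine ⟨ι, hι, w, ν, hν, hw, fun s E hE => ?_⟩
  have := fun s => (hP s).1
  have hm := measurable_readOut (Λ := Λ) s
  have hmap : ∀ i, IsProbabilityMeasure ((ν i).map (readOut s)) := fun i =>
    Measure.isProbabilityMeasure_map hm.aemeasurable
  have key := real_eq_sum_of_rectangles w (P s) (fun i => (ν i).map (readOut s)) (fun F hF => ?_)
    E hE
  · rw [key]
    exact Finset.sum_congr rfl fun i _ => by rw [map_measureReal_apply hm hE]
  · have h1 := congrArg Complex.re ((hP s).2 F hF)
    rw [Complex.ofReal_re] at h1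
    refine h1.trans ((hR _ fun n => (M n (s n)).isPositive _ (hF n)).trans ?_)
    refine Finset.sum_congr rfl fun i _ => ?_
    have e : readOut s ⁻¹' Set.univ.pi F
        = Set.univ.pi fun n => (fun a : Fin (S n) → Λ n => a (s n)) ⁻¹' F n := by
      ext ω
      simp [readOut]
    rw [map_measureReal_apply hm (.univ_pi hF), e, measureReal_def, Measure.pi_pi,
      ENNReal.toReal_prod]
    congr 1
    refine Finset.prod_congr rfl fun n _ => ?_
    rw [← hμF i n (s n) (F n) (hF n),
      (measurePreserving_eval (μ i n) (s n)).measure_preimage (hF n).nullMeasurableSet,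
      measureReal_def]

end ProductMeasures

theorem opTrace_eq_trace {K : Type v} [NormedAddCommGroup K] [InnerProductSpace ℂ K]
    [CompleteSpace K] [FiniteDimensional ℂ K] (T : K →L[ℂ] K) :
    opTrace T = LinearMap.trace ℂ K T.toLinearMap := by
  obtain ⟨b, hb⟩ := (exists_hilbertBasis ℂ K).choose_spec
  have hfin : Finite (exists_hilbertBasis ℂ K).choose := b.orthonormal.linearIndependent.finite
  have := Fintype.ofFinite (exists_hilbertBasis ℂ K).choose
  rw [opTrace, tsum_fintype, LinearMap.trace_eq_sum_inner _ b.toOrthonormalBasis]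
  simp [diagElem, hb]

/-! ### Finite dimension: Schmidt-like expansion and the bound by `d` -/

section FiniteDimensional

variable {N d : ℕ}

/-- The product basis vector `e_{k₁} ⊗ ⋯ ⊗ e_{k_N}`. -/
def productBasisVector (k : Fin N → Fin d) :
    HilbertTensor fun _ : Fin N => EuclideanSpace ℂ (Fin d) :=
  tprod fun n => EuclideanSpace.basisFun (Fin d) ℂ (k n)

theorem orthonormal_productBasisVector :
    Orthonormal ℂ (productBasisVector : (Fin N → Fin d) → _) := by
  rw [orthonormal_iff_ite]
  intro k l
  rw [productBasisVector, productBasisVector, inner_tprod]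
  simp only [orthonormal_iff_ite.1 (EuclideanSpace.basisFun (Fin d) ℂ).orthonormal]
  rw [Finset.prod_ite_zero]
  simp [funext_iff]

theorem coe_mem_span_productBasisVector
    (t : AlgTensor fun _ : Fin N => EuclideanSpace ℂ (Fin d)) :
    (t : HilbertTensor fun _ : Fin N => EuclideanSpace ℂ (Fin d)) ∈
      Submodule.span ℂ (Set.range (productBasisVector : (Fin N → Fin d) → _)) := by
  induction t using AlgTensor.induction with
  | h1 c x =>
    have e : AlgTensor.tprod x = ∑ k : Fin N → Fin d, (∏ n, x n (k n)) •
        AlgTensor.tprod fun n => EuclideanSpace.basisFun (Fin d) ℂ (k n) := by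
      have hx : x = fun n => ∑ j, x n j • EuclideanSpace.basisFun (Fin d) ℂ j := by
        funext n
        exact ((EuclideanSpace.basisFun (Fin d) ℂ).sum_repr (x n)).symm
      conv_lhs => rw [hx]
      refine ((PiTensorProduct.tprod ℂ).map_sum _).trans (Finset.sum_congr rfl fun k _ => ?_)
      exact (PiTensorProduct.tprod ℂ).map_smul_univ _ _
    rw [e, ← UniformSpace.Completion.coe_toComplL (𝕜 := ℂ), map_smul, map_sum]
    refine Submodule.smul_mem _ _ (Submodule.sum_mem _ fun k _ => ?_)
    rw [map_smul]
    exact Submodule.smul_mem _ _ (Submodule.subset_span ⟨k, rfl⟩)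
  | h2 a b ha hb =>
    rw [UniformSpace.Completion.coe_add]
    exact Submodule.add_mem _ ha hb

/-- The orthonormal product basis of `(ℂ^d)^{⊗N}`. -/
def productBasis : OrthonormalBasis (Fin N → Fin d) ℂ
    (HilbertTensor fun _ : Fin N => EuclideanSpace ℂ (Fin d)) :=
  (HilbertBasis.mk orthonormal_productBasisVector (by
    intro z _
    have hz := UniformSpace.Completion.denseRange_coe
      (α := AlgTensor fun _ : Fin N => EuclideanSpace ℂ (Fin d)) z
    refine closure_mono ?_ hz
    rintro _ ⟨t, rfl⟩
    exact coe_mem_span_productBasisVector t)).toOrthonormalBasis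

theorem productBasis_apply (k : Fin N → Fin d) : productBasis k = productBasisVector k := by
  rw [productBasis, HilbertBasis.coe_toOrthonormalBasis]
  exact congrFun (HilbertBasis.coe_mk _ _) k

instance : FiniteDimensional ℂ (HilbertTensor fun _ : Fin N => EuclideanSpace ℂ (Fin d)) :=
  productBasis.toBasis.finiteDimensional_of_finite

/-- The expansion in the product basis is grouped by the last `m` indices. Leaving site `0` free
keeps the number of terms at `d ^ m`, and Parseval gives the norms. -/
theorem exists_sum_tprod_cons {m : ℕ}
    (ψ : HilbertTensor fun _ : Fin (m + 1) => EuclideanSpace ℂ (Fin d)) :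
    ∃ x : (Fin m → Fin d) → EuclideanSpace ℂ (Fin d), ∑ κ, ‖x κ‖ ^ 2 = ‖ψ‖ ^ 2 ∧
      ψ = ∑ κ, tprod (Fin.cons (α := fun _ => EuclideanSpace ℂ (Fin d)) (x κ)
        fun n => EuclideanSpace.basisFun (Fin d) ℂ (κ n)) := by
  let c : (Fin (m + 1) → Fin d) → ℂ := fun k => inner ℂ (productBasis k) ψ
  let x : (Fin m → Fin d) → EuclideanSpace ℂ (Fin d) := fun κ =>
    WithLp.toLp 2 fun j => c (Fin.cons (α := fun _ => Fin d) j κ)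
  refine ⟨x, ?_, ?_⟩
  · rw [← productBasis.sum_sq_norm_inner_right ψ,
      ← (Fin.consEquiv fun _ : Fin (m + 1) => Fin d).sum_comp, Fintype.sum_prod_type,
      Finset.sum_comm]
    refine Finset.sum_congr rfl fun κ _ => ?_
    rw [EuclideanSpace.norm_sq_eq]
    rfl
  · refine InnerProductSpace.ext_inner_left_basis (𝕜 := ℂ) productBasis.toBasis fun k => ?_
    rw [OrthonormalBasis.coe_toBasis, inner_sum, Finset.sum_eq_single (Fin.tail k)]
    · rw [productBasis_apply, productBasisVector, inner_tprod, Fin.prod_univ_succ]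
      simp only [Fin.cons_zero, Fin.cons_succ, Fin.tail, EuclideanSpace.basisFun_inner,
        OrthonormalBasis.inner_eq_one, Finset.prod_const_one, mul_one]
      change _ = c (Fin.cons (α := fun _ => Fin d) (k 0) (Fin.tail k))
      rw [Fin.cons_self_tail]
      simp only [c, productBasis_apply]
      rfl
    · intro κ _ hκ
      rw [productBasis_apply, productBasisVector, inner_tprod, Fin.prod_univ_succ]
      obtain ⟨n, hn⟩ := Function.ne_iff.1 hκ
      refine mul_eq_zero_of_right _ (Finset.prod_eq_zero (Finset.mem_univ n) ?_)
      rw [Fin.cons_succ, (EuclideanSpace.basisFun (Fin d) ℂ).inner_eq_zero]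
      exact fun h => hn h.symm
    · simp

theorem productDecomp_inner_tensorOp {m : ℕ} (hd : 0 < d)
    (ψ : HilbertTensor fun _ : Fin (m + 1) => EuclideanSpace ℂ (Fin d)) (hψ : ‖ψ‖ = 1) :
    ProductDecomp (fun X : ∀ _ : Fin (m + 1), EuclideanSpace ℂ (Fin d) →L[ℂ]
      EuclideanSpace ℂ (Fin d) => (inner ℂ ψ (tensorOp X ψ)).re)
      (2 ^ m * ((d : ℝ) ^ m - 1) + 1) := by
  have : Nontrivial (EuclideanSpace ℂ (Fin d)) := by
    have : NeZero d := ⟨hd.ne'⟩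
    infer_instance
  obtain ⟨x, hx, hψx⟩ := exists_sum_tprod_cons ψ
  let y : (Fin m → Fin d) → Fin (m + 1) → EuclideanSpace ℂ (Fin d) := fun κ =>
    Fin.cons (α := fun _ => EuclideanSpace ℂ (Fin d)) (x κ)
      fun n => EuclideanSpace.basisFun (Fin d) ℂ (κ n)
  -- Costs of the terms `(κ, l)`: off the diagonal, site `0` gives `‖x κ‖ ^ 2 + ‖x l‖ ^ 2`, each of
  -- the `m` basis sites a factor `1 + 1`, and polarization the half.
  let c : (Fin m → Fin d) × (Fin m → Fin d) → ℝ := fun q =>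
    if q.1 = q.2 then ‖x q.1‖ ^ 2 else 2 ^ m * (‖x q.1‖ ^ 2 + ‖x q.2‖ ^ 2) / 2
  have hterm : ∀ q : (Fin m → Fin d) × (Fin m → Fin d),
      ProductDecomp (fun X : ∀ _ : Fin (m + 1), EuclideanSpace ℂ (Fin d) →L[ℂ]
        EuclideanSpace ℂ (Fin d) => (∏ n, inner ℂ (y q.1 n) (X n (y q.2 n))).re) (c q) := by
    rintro ⟨κ, l⟩
    by_cases h : κ = l
    · subst h
      refine (productDecomp_pure (y κ)).mono (le_of_eq ?_)
      simp [c, y, Fin.prod_univ_succ]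
    · refine (productDecomp_offDiagonal (y κ) (y l)).mono (le_of_eq ?_)
      simp only [c, y, Fin.prod_univ_succ, Fin.cons_zero, Fin.cons_succ,
        OrthonormalBasis.norm_eq_one, h, if_false, Finset.prod_const, Finset.card_univ,
        Fintype.card_fin]
      norm_num
      ring
  have hsum := ProductDecomp.sum (a := fun _ => (1 : ℝ)) (fun _ => zero_le_one) hterm
  refine (hsum.mono (le_of_eq ?_)).congr fun X _ => ?_
  · have hc : ∀ κ l, c (κ, l) = 2 ^ m * (‖x κ‖ ^ 2 + ‖x l‖ ^ 2) / 2
        + if κ = l then (1 - 2 ^ m) * ‖x κ‖ ^ 2 else 0 := fun κ l => by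
      by_cases h : κ = l
      · subst h; simp only [c, if_true]; ring
      · simp [c, h]
    rw [Fintype.sum_prod_type]
    simp only [one_mul, hc, Finset.sum_add_distrib, Finset.sum_ite_eq, Finset.mem_univ, if_true,
      ← Finset.mul_sum, ← Finset.sum_div, hx, hψ, Finset.sum_const, Finset.card_univ,
      Fintype.card_fun, Fintype.card_fin, nsmul_eq_mul]
    push_cast
    ring
  · have h1 : inner ℂ ψ (tensorOp X ψ)
        = ∑ κ, ∑ l, ∏ n, inner ℂ (y κ n) (X n (y l n)) := by
      conv_lhs => rw [hψx]
      rw [map_sum, sum_inner]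
      refine Finset.sum_congr rfl fun κ _ => ?_
      rw [inner_sum]
      refine Finset.sum_congr rfl fun l _ => ?_
      rw [tensorOp_tprod, inner_tprod]
    rw [h1, Fintype.sum_prod_type]
    simp only [Complex.re_sum, one_mul]

/-- By the spectral theorem `ρ` is a convex combination of eigenprojections, since its eigenvalues
are nonnegative with sum `1`; the bound for unit vectors therefore passes to `ρ`. -/
theorem productDecomp_opTrace {m : ℕ}
    {ρ : HilbertTensor (fun _ : Fin (m + 1) => EuclideanSpace ℂ (Fin d)) →L[ℂ]
      HilbertTensor (fun _ : Fin (m + 1) => EuclideanSpace ℂ (Fin d))} (hρ : IsState ρ) :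
    ProductDecomp (fun X : ∀ _ : Fin (m + 1), EuclideanSpace ℂ (Fin d) →L[ℂ]
      EuclideanSpace ℂ (Fin d) => (opTrace (ρ ∘L tensorOp X)).re)
      (2 ^ m * ((d : ℝ) ^ m - 1) + 1) := by
  have htr := hρ.trace_eq_one
  rw [opTrace_eq_trace] at htr
  -- For `d = 0` the product basis is empty and the trace would be `0`.
  have hd : 0 < d := by
    rcases Nat.eq_zero_or_pos d with rfl | hd
    · rw [LinearMap.trace_eq_sum_inner _ productBasis] at htr
      simp at htr
    · exact hd
  have hpos : (ρ.toLinearMap).IsPositive := hρ.isPositive.toLinearMap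
  have hsym := hpos.isSymmetric
  let b := hsym.eigenvectorBasis rfl
  let a := hsym.eigenvalues rfl
  have ha : ∀ i, 0 ≤ a i := hpos.nonneg_eigenvalues rfl
  have ha1 : ∑ i, a i = 1 := by
    have := hsym.re_trace_eq_sum_eigenvalues rfl
    rw [htr] at this
    simpa using this.symm
  have hsum := ProductDecomp.sum ha
    fun i => productDecomp_inner_tensorOp hd (b i) (b.norm_eq_one i)
  refine (hsum.mono (le_of_eq ?_)).congr fun X _ => ?_
  · rw [← Finset.sum_mul, ha1, one_mul]
  · rw [opTrace_eq_trace, LinearMap.trace_eq_sum_inner _ b, Complex.re_sum]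
    refine Finset.sum_congr rfl fun i _ => ?_
    have h1 : inner ℂ (b i) (ρ (tensorOp X (b i))) = inner ℂ (ρ (b i)) (tensorOp X (b i)) :=
      (hsym _ _).symm
    have h2 : ρ (b i) = (a i : ℂ) • b i := hsym.apply_eigenvectorBasis rfl i
    change (inner ℂ (b i) (ρ (tensorOp X (b i)))).re = _
    rw [h1, h2, inner_smul_left, Complex.conj_ofReal, Complex.re_ofReal_mul]

end FiniteDimensional

end BellViolation

end

theorem corollary2 (N : ℕ) (hN : 2 ≤ N) :
    (∀ (H : Fin N → Type v) [∀ n, NormedAddCommGroup (H n)] [∀ n, InnerProductSpace ℂ (H n)]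
        [∀ n, CompleteSpace (H n)]
        (ρ : BellViolation.HilbertTensor H →L[ℂ] BellViolation.HilbertTensor H),
        BellViolation.IsState ρ → ∀ S : ℕ, 1 ≤ S →
        BellViolation.ViolationAtMost.{u, v} ρ (fun _ => S) ((2 * (S : ℝ) - 1) ^ (N - 1)) ∧
        BellViolation.maxBellViolation.{u, v} ρ (fun _ => S)
          ≤ ENNReal.ofReal ((2 * (S : ℝ) - 1) ^ (N - 1))) ∧
    (∀ (d : ℕ)
        (ρ : BellViolation.HilbertTensor (fun _ : Fin N => EuclideanSpace ℂ (Fin d)) →L[ℂ]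
          BellViolation.HilbertTensor (fun _ : Fin N => EuclideanSpace ℂ (Fin d))),
        BellViolation.IsState ρ → ∀ S : Fin N → ℕ, (∀ n, 1 ≤ S n) →
        BellViolation.ViolationAtMost.{u, 0} ρ S (2 ^ (N - 1) * ((d : ℝ) ^ (N - 1) - 1) + 1) ∧
        BellViolation.maxBellViolation.{u, 0} ρ S
          ≤ ENNReal.ofReal (2 ^ (N - 1) * ((d : ℝ) ^ (N - 1) - 1) + 1)) := by
  obtain ⟨m, rfl⟩ : ∃ m, N = m + 1 := ⟨N - 1, by omega⟩
  constructor
  · intro H _ _ _ ρ _ S hS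
    refine BellViolation.violation_bounds_of_quasiModel ρ (fun _ => hS) _
      fun Λ _ _ M P hP => ?_
    have := fun s => (hP s).1
    -- With `r = 0`, the product over the `m` remaining sites is a power.
    simpa using hP.noSignaling.quasiModel 0 fun _ => hS
  · intro d ρ hρ S hS
    exact BellViolation.violation_bounds_of_quasiModel ρ hS _ fun Λ _ _ M P hP =>
      BellViolation.ProductDecomp.quasiModel hP (BellViolation.productDecomp_opTrace hρ)
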